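/- Let $b\ge 2$, $\Lambda=\{0,\dots,b-1\}$, and let $\Sigma=\Lambda^{\mathbb N}$ be the space of infinite words $x=x_1x_2\cdots$ over $\Lambda$, with the product topology and its Borel $\sigma$-field. For $x\in\Sigma$ write $x|_n=x_1\cdots x_n$, and let $[x|_n]$ be the cylinder of all $y\in\Sigma$ with $y|_n=x|_n$. A finite Borel measure $\mu$ on $\Sigma$ is called exact-dimensional with dimension $D$ if $D>0$ and $$\liminf_{n\to\infty}\frac{-\log\mu([x|_n])}{n}=\limsup_{n\to\infty}\frac{-\log\mu([x|_n])}{n}=D\qquad\text{for }\mu\text{-almost every }x\in\Sigma .$$ Let $X\ge 0$ be a random variable with $\mathbb E(X)=1$, and set $h_X=\mathbb E(X\log X)\in[0,\infty]$, with the convention $0\log 0=0$. Let $(X_u)$, indexed by the nonempty finite words $u$ over $\Lambda$, be independent random variables with the law of $X$, defined on a probability space $(\Omega,\mathcal A,\mathbb P)$. For $n\ge 0$, $\omega\in\Omega$ and $x\in\Sigma$ put $Q_n(\omega,x)=\prod_{k=1}^n X_{x|_k}(\omega)$. For a Borel probability measure $\nu$ on $\Sigma$, let $Q\cdot\nu$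 be the weak limit, as $n\to\infty$, of the random measures $Q_n(\omega,x)\,\nu(\mathrm dx)$. **Corollary.** Let $\nu$ be a Borel probability measure on $\Sigma$ which is exact-dimensional with dimension $D>h_X$. Then the weak limit $Q\cdot\nu$ exists almost surely, the event $\{Q\cdot\nu\ne 0\}$ has positive probability, and almost surely, conditional on $Q\cdot\nu\neq 0$, the measure $Q\cdot\nu$ is exact-dimensional with dimension $D-h_X$. -/

import Mathlib

open Filter MeasureTheory ProbabilityTheory
open scoped Topology NNReal ENNReal

noncomputable section

/-- The one-sided symbolic space over the alphabet `{0, …, b-1}`, with the product topology and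
its Borel (= product) σ-field. The letters of `x` are `x 0, x 1, …`. -/
abbrev SymbolicSpace (b : ℕ) : Type := ℕ → Fin b

namespace SymbolicSpace

variable {b : ℕ}

/-- The finite word formed by the first `n` letters of `x`. -/
def take (x : SymbolicSpace b) (n : ℕ) : List (Fin b) :=
  List.ofFn fun i : Fin n => x i

/-- Lower local dimension of `μ` at `x`: the lower limit of `-log μ([x|_n]) / n`.
Here `PiNat.cylinder x n` is the set of sequences with the same first `n` letters as `x`, and
`ENNReal.log` is the logarithm with values in `[-∞, ∞]`. -/
def lowerLocalDim (μ : Measure (SymbolicSpace b)) (x : SymbolicSpace b) : EReal :=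
  liminf (fun n : ℕ => -ENNReal.log (μ (PiNat.cylinder x n)) / (n : EReal)) atTop

/-- Upper local dimension of `μ` at `x`: the upper limit of `-log μ([x|_n]) / n`. -/
def upperLocalDim (μ : Measure (SymbolicSpace b)) (x : SymbolicSpace b) : EReal :=
  limsup (fun n : ℕ => -ENNReal.log (μ (PiNat.cylinder x n)) / (n : EReal)) atTop

/-- `μ` is exact-dimensional with dimension `D`: `D > 0`, and at `μ`-almost every point the local
dimension of `μ` exists and equals `D`. -/
def IsExactDimensional (μ : Measure (SymbolicSpace b)) (D : ℝ) : Prop :=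
  0 < D ∧ ∀ᵐ x ∂μ, lowerLocalDim μ x = (D : EReal) ∧ upperLocalDim μ x = (D : EReal)

end SymbolicSpace

/-- `E(X log X)` for a nonnegative random variable `X`, with values in `[-∞, ∞]` and with
`0 log 0 = 0`: the expectation of the positive part minus the expectation of the negative part.
The latter is at most `e⁻¹` when `P` is a probability measure. -/
def entropyXLogX {Ω : Type*} [MeasurableSpace Ω] (P : Measure Ω) (X : Ω → ℝ≥0) : EReal :=
  ((∫⁻ ω, ENNReal.ofReal ((X ω : ℝ) * Real.log (X ω)) ∂P : ℝ≥0∞) : EReal)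
    - ((∫⁻ ω, ENNReal.ofReal (-((X ω : ℝ) * Real.log (X ω))) ∂P : ℝ≥0∞) : EReal)

/-- The weights of a Mandelbrot multiplicative cascade: the nonnegative random variables `W u`,
indexed by the nonempty finite words `u`, are independent and all have the law of `X`, which has
expectation one. (The value of `W` at the empty word plays no role.) -/
structure IsMandelbrotCascade {b : ℕ} {Ω Ω' : Type*} [MeasurableSpace Ω] [MeasurableSpace Ω']
    (P : Measure Ω) (W : List (Fin b) → Ω → ℝ≥0) (P' : Measure Ω') (X : Ω' → ℝ≥0) : Prop where
  measurable : ∀ u, u ≠ [] → Measurable (W u)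
  indep : iIndepFun (fun u : {u : List (Fin b) // u ≠ []} => W u.1) P
  identDistrib : ∀ u, u ≠ [] → IdentDistrib (W u) X P P'
  mean_one : ∫⁻ ω, (X ω : ℝ≥0∞) ∂P' = 1

section Action

variable {b : ℕ} {Ω : Type*}

/-- `Q_n(ω, x)`, the product of the weights of the words `x|_1, …, x|_n`. -/
def cascadeDensity (W : List (Fin b) → Ω → ℝ≥0) (n : ℕ) (ω : Ω) (x : SymbolicSpace b) : ℝ≥0 :=
  ∏ k ∈ Finset.range n, W (x.take (k + 1)) ω

theorem cascadeDensity_bounded (W : List (Fin b) → Ω → ℝ≥0) (n : ℕ) (ω : Ω) :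
    ∃ C : ℝ≥0, ∀ x, cascadeDensity W n ω x ≤ C := by
  refine ⟨∏ k ∈ Finset.range n,
    ∑ v : Fin (k + 1) → Fin b, W (List.ofFn v) ω, fun x => ?_⟩
  refine Finset.prod_le_prod' fun k _ => ?_
  exact Finset.single_le_sum (f := fun v : Fin (k + 1) → Fin b => W (List.ofFn v) ω)
    (fun _ _ => zero_le) (Finset.mem_univ fun i : Fin (k + 1) => x i)

/-- The measure with density `Q_n(ω, ·)` with respect to `ν`. -/
def cascadeMeasure (W : List (Fin b) → Ω → ℝ≥0) (ν : Measure (SymbolicSpace b))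
    [IsFiniteMeasure ν] (n : ℕ) (ω : Ω) : FiniteMeasure (SymbolicSpace b) :=
  ⟨ν.withDensity fun x => (cascadeDensity W n ω x : ℝ≥0∞), by
    obtain ⟨C, hC⟩ := cascadeDensity_bounded W n ω
    refine isFiniteMeasure_withDensity (ne_top_of_le_ne_top
      (ENNReal.mul_ne_top (ENNReal.coe_ne_top (r := C)) (measure_ne_top ν Set.univ)) ?_)
    exact (lintegral_mono fun x => ENNReal.coe_le_coe.2 (hC x)).trans_eq (lintegral_const _)⟩

/-- The random measure `Q·ν`: the limit, in the weak topology of finite measures, of the measures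
with density `Q_n(ω, ·)` with respect to `ν` (an arbitrary value if there is no limit). -/
def cascadeLimit (W : List (Fin b) → Ω → ℝ≥0) (ν : Measure (SymbolicSpace b))
    [IsFiniteMeasure ν] (ω : Ω) : FiniteMeasure (SymbolicSpace b) :=
  limUnder atTop fun n => cascadeMeasure W ν n ω

end Action

end

/-! The masses `Q_n ν(s)` of a fixed set form a nonnegative martingale of mean `ν(s)`. Applied to
the countably many cylinders, this gives the almost sure weak limit.

For the dimension, write `h = E(X log X)` and `c = D - h`, and work on `Ω × Σ` under the Peyrière
measure with density `Q_m(ω, x)` with respect to `P ⊗ ν`. Given `x`, the weights along `x` up to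
level `m` are then i.i.d. with the size-biased law, under which `log` has mean `h`. By the law of
large numbers and exact dimensionality of `ν`, `Q_k(x) ν([x|_k])` is about `exp(-kc)`.

It remains to compare this product with `(Q_m ν)([x|_k])`, uniformly in `m`. The mass is rarely much
smaller, by a sum over words of length `k` (`peyriereMeasure_lt_mul_le`). It is rarely much larger:
splitting the cylinder by the level `j` at which a point leaves `x`, the factors after the branching
have mean one, and what is left is a geometric series in `exp(-(c - ε))`, convergent because `c > 0`
(`lintegral_cylinder_le`, then Markov).

The resulting bounds concern finitely many cylinders, so they pass to the weak limit by Fatou. They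
also exclude a limit that vanishes almost surely: up to a small mean error, the mass of `Q_m ν` sits
on cylinders of bounded mass, so it cannot disappear in the limit while its mean stays equal to one.
-/

/-! ### Local dimension as two-sided exponential bounds on cylinder masses. -/

section LocalDimension

theorem neg_log_div_le_iff {a : ℝ≥0∞} {n : ℕ} (hn : 0 < n) (r : ℝ) :
    -ENNReal.log a / (n : EReal) ≤ (r : EReal) ↔ ENNReal.ofReal (Real.exp (-(n * r))) ≤ a := by
  have hn' : (0 : EReal) < (n : EReal) := by exact_mod_cast hn
  rw [EReal.div_le_iff_le_mul hn' (EReal.natCast_ne_top n), EReal.neg_le,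
    ← ENNReal.log_le_log_iff, ENNReal.log_ofReal_of_pos (Real.exp_pos _), Real.log_exp]
  norm_cast

theorem le_neg_log_div_iff {a : ℝ≥0∞} {n : ℕ} (hn : 0 < n) (r : ℝ) :
    (r : EReal) ≤ -ENNReal.log a / (n : EReal) ↔ a ≤ ENNReal.ofReal (Real.exp (-(n * r))) := by
  have hn' : (0 : EReal) < (n : EReal) := by exact_mod_cast hn
  rw [EReal.le_div_iff_mul_le hn' (EReal.natCast_ne_top n), EReal.le_neg,
    ← ENNReal.log_le_log_iff, ENNReal.log_ofReal_of_pos (Real.exp_pos _), Real.log_exp]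
  rw [mul_comm]
  norm_cast

/-- The interval `[exp (-k (c + ε)), exp (-k (c - ε))]`. -/
def decayInterval (c ε : ℝ) (k : ℕ) : Set ℝ≥0∞ :=
  Set.Icc (ENNReal.ofReal (Real.exp (-(k * (c + ε))))) (ENNReal.ofReal (Real.exp (-(k * (c - ε)))))

theorem eventually_mem_decayInterval_of_liminf_of_limsup {a : ℕ → ℝ≥0∞} {d : ℝ}
    (h₁ : liminf (fun n : ℕ => -ENNReal.log (a n) / (n : EReal)) atTop = (d : EReal))
    (h₂ : limsup (fun n : ℕ => -ENNReal.log (a n) / (n : EReal)) atTop = (d : EReal))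
    {ε : ℝ} (hε : 0 < ε) : ∀ᶠ n in atTop, a n ∈ decayInterval d ε n := by
  have ht := tendsto_of_liminf_eq_limsup h₁ h₂
  have hlo : ((d - ε : ℝ) : EReal) < d := by exact_mod_cast sub_lt_self d hε
  have hhi : (d : EReal) < ((d + ε : ℝ) : EReal) := by exact_mod_cast lt_add_of_pos_right d hε
  filter_upwards [ht.eventually (lt_mem_nhds hlo), ht.eventually (gt_mem_nhds hhi),
    eventually_gt_atTop 0] with n hn₁ hn₂ hn
  exact ⟨(neg_log_div_le_iff hn _).1 hn₂.le, (le_neg_log_div_iff hn _).1 hn₁.le⟩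

/-- A sequence of tolerances suffices, so only countably many almost sure statements have to be
combined. -/
theorem liminf_limsup_eq_of_mem_decayInterval {a : ℕ → ℝ≥0∞} {d : ℝ} {e : ℕ → ℝ}
    (he : Tendsto e atTop (𝓝 0)) (h : ∀ j, ∀ᶠ n in atTop, a n ∈ decayInterval d (e j) n) :
    liminf (fun n : ℕ => -ENNReal.log (a n) / (n : EReal)) atTop = (d : EReal) ∧
      limsup (fun n : ℕ => -ENNReal.log (a n) / (n : EReal)) atTop = (d : EReal) := by
  have hb : ∀ j, ∀ᶠ n : ℕ in atTop, ((d - e j : ℝ) : EReal) ≤ -ENNReal.log (a n) / (n : EReal) ∧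
      -ENNReal.log (a n) / (n : EReal) ≤ ((d + e j : ℝ) : EReal) := fun j => by
    filter_upwards [h j, eventually_gt_atTop 0] with n hn hn0
    exact ⟨(le_neg_log_div_iff hn0 _).2 hn.2, (neg_log_div_le_iff hn0 _).2 hn.1⟩
  have hlo : (d : EReal) ≤ liminf (fun n : ℕ => -ENNReal.log (a n) / (n : EReal)) atTop := by
    have ht : Tendsto (fun j => ((d - e j : ℝ) : EReal)) atTop (𝓝 ((d - 0 : ℝ) : EReal)) :=
      (continuous_coe_real_ereal.tendsto _).comp (tendsto_const_nhds.sub he)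
    rw [sub_zero] at ht
    exact le_of_tendsto' ht fun j => le_liminf_of_le (h := (hb j).mono fun n hn => hn.1)
  have hhi : limsup (fun n : ℕ => -ENNReal.log (a n) / (n : EReal)) atTop ≤ (d : EReal) := by
    have ht : Tendsto (fun j => ((d + e j : ℝ) : EReal)) atTop (𝓝 ((d + 0 : ℝ) : EReal)) :=
      (continuous_coe_real_ereal.tendsto _).comp (tendsto_const_nhds.add he)
    rw [add_zero] at ht
    exact ge_of_tendsto' ht fun j => limsup_le_of_le (h := (hb j).mono fun n hn => hn.2)
  have hle := liminf_le_limsup (u := fun n : ℕ => -ENNReal.log (a n) / (n : EReal)) (f := atTop)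
  exact ⟨le_antisymm (hle.trans hhi) hlo, le_antisymm hhi (hlo.trans hle)⟩

end LocalDimension

/-! ### Cylinders and weak convergence on the symbolic space. -/

section Cylinders

open PiNat

variable {b : ℕ}

/-- The hypothesis makes `s` a union of level-`M` cylinders. Since lying in a common cylinder is
symmetric, it passes to the complement. -/
theorem SymbolicSpace.isClopen_of_cylinder {M : ℕ} {s : Set (SymbolicSpace b)}
    (h : ∀ x y, y ∈ PiNat.cylinder x M → x ∈ s → y ∈ s) : IsClopen s := by
  constructor
  · rw [← isOpen_compl_iff, isOpen_iff_mem_nhds]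
    intro x hx
    filter_upwards [(isOpen_cylinder _ x M).mem_nhds (self_mem_cylinder x M)] with y hy hys
    exact hx (h y x ((mem_cylinder_comm x y M).1 hy) hys)
  · rw [isOpen_iff_mem_nhds]
    intro x hx
    filter_upwards [(isOpen_cylinder _ x M).mem_nhds (self_mem_cylinder x M)] with y hy
    exact h x y hy hx

theorem SymbolicSpace.isClopen_cylinder (x : SymbolicSpace b) (n : ℕ) : IsClopen (PiNat.cylinder x n) :=
  isClopen_of_cylinder (M := n) fun y z hz hy => by
    rw [mem_cylinder_iff_eq] at hy hz ⊢
    rw [hz, hy]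

theorem SymbolicSpace.isPiSystem_cylinder :
    IsPiSystem {s : Set (SymbolicSpace b) | ∃ x n, s = PiNat.cylinder x n} := by
  rintro _ ⟨x, n, rfl⟩ _ ⟨y, m, rfl⟩ ⟨z, hzx, hzy⟩
  rw [mem_cylinder_iff_eq] at hzx hzy
  rw [← hzx, ← hzy]
  rcases le_total n m with h | h
  · exact ⟨z, m, Set.inter_eq_right.2 (cylinder_anti z h)⟩
  · exact ⟨z, n, Set.inter_eq_left.2 (cylinder_anti z h)⟩

theorem SymbolicSpace.measure_ext [Nonempty (SymbolicSpace b)] {μ ν : Measure (SymbolicSpace b)}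
    [IsFiniteMeasure μ] (h : ∀ x n, μ (PiNat.cylinder x n) = ν (PiNat.cylinder x n)) : μ = ν := by
  refine ext_of_generate_finite _ ?_ isPiSystem_cylinder ?_ ?_
  · rw [← (isTopologicalBasis_cylinders (fun _ : ℕ => Fin b)).borel_eq_generateFrom]
    exact BorelSpace.measurable_eq
  · rintro _ ⟨x, n, rfl⟩
    exact h x n
  · simpa using h (Classical.arbitrary _) 0

/-- Masses of clopen sets are continuous for the weak topology. -/
theorem FiniteMeasure.continuous_apply_of_isClopen {E : Type*} [TopologicalSpace E]
    [MeasurableSpace E] [OpensMeasurableSpace E] {s : Set E} (hs : IsClopen s) :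
    Continuous fun μ : FiniteMeasure E => μ s := by
  let f : BoundedContinuousFunction E ℝ≥0 := BoundedContinuousFunction.mkOfBound
    ⟨s.indicator 1, continuous_indicator (by simp [hs.frontier_eq]) continuous_const.continuousOn⟩ 1
    (fun x y => by
      by_cases hx : x ∈ s <;> by_cases hy : y ∈ s <;> simp [hx, hy, NNReal.dist_eq])
  have := FiniteMeasure.continuous_testAgainstNN_eval (Ω := E) f
  convert this using 2 with μ
  have h : (fun x => (f x : ℝ≥0∞)) = s.indicator 1 := by
    ext x
    by_cases hx : x ∈ s <;> simp [f, hx]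
  rw [FiniteMeasure.testAgainstNN, h, lintegral_indicator_one hs.isClosed.measurableSet]
  rfl

/-- Finite measures on the symbolic space whose cylinder masses all converge have a weak limit. -/
theorem SymbolicSpace.exists_tendsto_of_cylinder [Nonempty (SymbolicSpace b)]
    {μ : ℕ → FiniteMeasure (SymbolicSpace b)}
    (h : ∀ x n, ∃ a, Tendsto (fun m => μ m (PiNat.cylinder x n)) atTop (𝓝 a)) :
    ∃ μ', Tendsto μ atTop (𝓝 μ') := by
  obtain ⟨a, ha⟩ := h (Classical.arbitrary _) 0
  rw [cylinder_zero] at ha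
  obtain ⟨C, hC⟩ := ha.bddAbove_range
  -- The level-0 cylinder is the whole space, so the total masses converge and are bounded by `C`.
  -- Weak compactness then reduces convergence to uniqueness of the cluster point, which its
  -- cylinder masses determine.
  have hK := isCompact_setOfPred_finiteMeasure_le_of_compactSpace (SymbolicSpace b) C
  have hmem : ∀ m, μ m ∈ {μ : FiniteMeasure (SymbolicSpace b) | μ.mass ≤ C} :=
    fun m => hC ⟨m, rfl⟩
  obtain ⟨μ', -, hμ'⟩ := hK.exists_mapClusterPt_of_frequently (l := atTop) (f := μ)
    (Frequently.of_forall hmem)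
  refine ⟨μ', hK.tendsto_nhds_of_unique_mapClusterPt (Eventually.of_forall hmem) ?_⟩
  intro ρ _ hρ
  have key : ∀ σ, MapClusterPt σ atTop μ → ∀ x n a,
      Tendsto (fun m => μ m (PiNat.cylinder x n)) atTop (𝓝 a) → σ (PiNat.cylinder x n) = a := by
    intro σ hσ x n a ha
    have h1 := hσ.continuousAt_comp
      (FiniteMeasure.continuous_apply_of_isClopen (isClopen_cylinder x n)).continuousAt
    exact eq_of_nhds_neBot (ClusterPt.mono h1 ha)
  refine Subtype.ext (@measure_ext _ _ _ _ ρ.prop ?_)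
  intro x n
  obtain ⟨a, ha⟩ := h x n
  have := (key ρ hρ x n a ha).trans (key μ' hμ' x n a ha).symm
  have hρ' : IsFiniteMeasure ρ.1 := ρ.2
  have hμ' : IsFiniteMeasure μ'.1 := μ'.2
  exact (ENNReal.toNNReal_eq_toNNReal_iff' (measure_ne_top ρ.1 _) (measure_ne_top μ'.1 _)).1 this

end Cylinders

/-! ### Functions of finitely many letters. -/

section LevelFunctions

variable {b : ℕ}

theorem SymbolicSpace.take_eq_of_mem_cylinder {x y : SymbolicSpace b} {m n : ℕ}
    (h : y ∈ PiNat.cylinder x m) (hn : n ≤ m) : y.take n = x.take n := by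
  unfold SymbolicSpace.take
  congr 1
  ext i
  rw [h i (i.2.trans_le hn)]

theorem SymbolicSpace.take_ne_nil (x : SymbolicSpace b) (n : ℕ) : x.take (n + 1) ≠ [] := by
  simp [SymbolicSpace.take]

@[simp] theorem SymbolicSpace.length_take (x : SymbolicSpace b) (n : ℕ) :
    (x.take n).length = n := by
  simp [SymbolicSpace.take]

theorem SymbolicSpace.mem_cylinder_of_take_eq {x y : SymbolicSpace b} {n : ℕ}
    (h : y.take n = x.take n) : y ∈ PiNat.cylinder x n := by
  intro i hi
  have := congrFun (List.ofFn_injective h) ⟨i, hi⟩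
  exact this

/-- The point of the symbolic space with the given first letters. -/
def SymbolicSpace.extend [NeZero b] (m : ℕ) (v : Fin m → Fin b) : SymbolicSpace b :=
  fun i => if h : i < m then v ⟨i, h⟩ else 0

theorem SymbolicSpace.mem_cylinder_extend [NeZero b] (m : ℕ) (x : SymbolicSpace b) :
    x ∈ PiNat.cylinder (extend m fun i => x i) m := by
  intro i hi
  simp [extend, hi]

/-- `F` factors through `Ω` times the finite set of words of length `m`. The σ-algebra `mΩ` is left
free so that the members of a filtration can be used. -/
theorem SymbolicSpace.measurable_uncurry_of_cylinder [NeZero b] {Ω β : Type*} {mΩ : MeasurableSpace Ω}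
    [MeasurableSpace β] {F : Ω → SymbolicSpace b → β} (m : ℕ)
    (hF : ∀ ω x y, y ∈ PiNat.cylinder x m → F ω y = F ω x) (hm : ∀ x, Measurable fun ω => F ω x) :
    Measurable (Function.uncurry F) := by
  have h : Function.uncurry F = (fun p : Ω × (Fin m → Fin b) => F p.1 (extend m p.2)) ∘
      fun p : Ω × SymbolicSpace b => (p.1, fun i : Fin m => p.2 i) := by
    ext p
    exact hF p.1 _ _ (mem_cylinder_extend m p.2)
  rw [h]
  refine Measurable.comp (measurable_from_prod_countable_left fun v => hm (extend m v)) ?_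
  fun_prop

theorem SymbolicSpace.measurable_of_cylinder [NeZero b] {β : Type*}
    [MeasurableSpace β] {f : SymbolicSpace b → β} (m : ℕ)
    (hf : ∀ x y, y ∈ PiNat.cylinder x m → f y = f x) : Measurable f :=
  (measurable_uncurry_of_cylinder (Ω := Unit) (mΩ := inferInstance) (F := fun _ => f) m (fun _ => hf)
    fun _ => measurable_const).comp (measurable_prodMk_left (x := Unit.unit))

/-- The integral of a function of the first `k` letters is a sum over the words of length `k`. -/
theorem SymbolicSpace.lintegral_eq_sum [NeZero b] (μ : Measure (SymbolicSpace b)) {k : ℕ}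
    {f : SymbolicSpace b → ℝ≥0∞} (hf : ∀ x y, y ∈ PiNat.cylinder x k → f y = f x) :
    ∫⁻ x, f x ∂μ = ∑ v : Fin k → Fin b, f (extend k v) * μ (PiNat.cylinder (extend k v) k) := by
  have hr : Measurable fun (x : SymbolicSpace b) (i : Fin k) => x i := by fun_prop
  have h : f = (fun v => f (extend k v)) ∘ fun (x : SymbolicSpace b) (i : Fin k) => x i := by
    ext x
    exact hf _ _ (mem_cylinder_extend k x)
  conv_lhs => rw [h]
  simp only [Function.comp_apply]
  rw [← lintegral_map (f := fun v => f (extend k v)) (measurable_of_countable _) hr, lintegral_fintype]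
  refine Finset.sum_congr rfl fun v _ => ?_
  rw [Measure.map_apply hr (measurableSet_singleton v)]
  congr 2
  ext x
  simp only [Set.mem_preimage, Set.mem_singleton_iff, PiNat.mem_cylinder_iff]
  constructor
  · rintro rfl i hi
    simp [extend, hi]
  · intro h
    ext i
    rw [h i i.2]
    simp [extend]

end LevelFunctions

section Density

variable {b : ℕ} {Ω : Type*}

theorem cascadeDensity_congr (W : List (Fin b) → Ω → ℝ≥0) {m n : ℕ} (ω : Ω)
    {x y : SymbolicSpace b} (h : y ∈ PiNat.cylinder x m) (hn : n ≤ m) :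
    cascadeDensity W n ω y = cascadeDensity W n ω x :=
  Finset.prod_congr rfl fun k hk => by
    rw [SymbolicSpace.take_eq_of_mem_cylinder h ((Finset.mem_range.1 hk).trans_le hn)]

theorem measurable_cascadeDensity [NeZero b] (W : List (Fin b) → Ω → ℝ≥0) (n : ℕ) (ω : Ω) :
    Measurable fun x => (cascadeDensity W n ω x : ℝ≥0∞) :=
  SymbolicSpace.measurable_of_cylinder n fun _ _ h => by rw [cascadeDensity_congr W ω h le_rfl]

theorem cascadeMeasure_apply [NeZero b] (W : List (Fin b) → Ω → ℝ≥0)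
    (ν : Measure (SymbolicSpace b)) [IsFiniteMeasure ν] (n : ℕ) (ω : Ω)
    {s : Set (SymbolicSpace b)} (hs : MeasurableSet s) :
    (cascadeMeasure W ν n ω : Measure (SymbolicSpace b)) s =
      ∫⁻ x in s, cascadeDensity W n ω x ∂ν :=
  withDensity_apply _ hs

theorem cascadeDensity_succ (W : List (Fin b) → Ω → ℝ≥0) (n : ℕ) (ω : Ω) (x : SymbolicSpace b) :
    cascadeDensity W (n + 1) ω x = cascadeDensity W n ω x * W (x.take (n + 1)) ω :=
  Finset.prod_range_succ _ _

theorem cascadeDensity_eq_mul_prod_Ico (W : List (Fin b) → Ω → ℝ≥0) {k m : ℕ} (hkm : k ≤ m) (ω : Ω)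
    (x : SymbolicSpace b) :
    cascadeDensity W m ω x =
      cascadeDensity W k ω x * ∏ j ∈ Finset.Ico k m, W (x.take (j + 1)) ω :=
  (Finset.prod_range_mul_prod_Ico _ hkm).symm

end Density

/-! ### Independence of the weights, the mass martingale and existence of the weak limit. -/

namespace IsMandelbrotCascade

variable {b : ℕ} {Ω Ω' : Type*} [MeasurableSpace Ω] [MeasurableSpace Ω'] {P : Measure Ω}
  {P' : Measure Ω'} {W : List (Fin b) → Ω → ℝ≥0} {X : Ω' → ℝ≥0}

theorem lintegral_eq_one (hW : IsMandelbrotCascade P W P' X) {u : List (Fin b)} (hu : u ≠ []) :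
    ∫⁻ ω, (W u ω : ℝ≥0∞) ∂P = 1 := by
  have := (hW.identDistrib u hu).comp measurable_coe_nnreal_ennreal
  exact this.lintegral_eq.trans hW.mean_one

theorem measurable_take (hW : IsMandelbrotCascade P W P' X) (x : SymbolicSpace b) (n : ℕ) :
    Measurable (W (x.take (n + 1))) := hW.measurable _ (x.take_ne_nil n)

theorem measurable_cascadeDensity (hW : IsMandelbrotCascade P W P' X) (x : SymbolicSpace b)
    (n : ℕ) : Measurable fun ω => cascadeDensity W n ω x :=
  Finset.measurable_fun_prod _ fun k _ => hW.measurable_take x k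

/-- The σ-algebra generated by the weights of the words in `S`. -/
abbrev weightSigma (_ : IsMandelbrotCascade P W P' X) (S : Set {u : List (Fin b) // u ≠ []}) :
    MeasurableSpace Ω := ⨆ u ∈ S, MeasurableSpace.comap (W u.1) inferInstance

theorem weightSigma_le (hW : IsMandelbrotCascade P W P' X)
    (S : Set {u : List (Fin b) // u ≠ []}) : hW.weightSigma S ≤ ‹MeasurableSpace Ω› :=
  iSup₂_le fun u _ => (hW.measurable u.1 u.2).comap_le

theorem weightSigma_mono (hW : IsMandelbrotCascade P W P' X)
    {S T : Set {u : List (Fin b) // u ≠ []}} (h : S ⊆ T) : hW.weightSigma S ≤ hW.weightSigma T :=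
  biSup_mono h

theorem measurable_weightSigma (hW : IsMandelbrotCascade P W P' X)
    {S : Set {u : List (Fin b) // u ≠ []}} {u : List (Fin b)} (hu : u ≠ []) (huS : ⟨u, hu⟩ ∈ S) :
    Measurable[hW.weightSigma S] (W u) :=
  (comap_measurable (W u)).mono (le_iSup₂_of_le ⟨u, hu⟩ huS le_rfl) le_rfl

theorem indep_weightSigma (hW : IsMandelbrotCascade P W P' X)
    {S T : Set {u : List (Fin b) // u ≠ []}} (h : Disjoint S T) :
    Indep (hW.weightSigma S) (hW.weightSigma T) P :=
  indep_iSup_of_disjoint (m := fun u : {u : List (Fin b) // u ≠ []} =>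
    MeasurableSpace.comap (W u.1) inferInstance)
    (fun u => (hW.measurable u.1 u.2).comap_le) hW.indep h

/-- The word `x|_{n+1}` as a nonempty word. -/
def _root_.SymbolicSpace.word (x : SymbolicSpace b) (n : ℕ) : {u : List (Fin b) // u ≠ []} :=
  ⟨x.take (n + 1), x.take_ne_nil n⟩

theorem _root_.SymbolicSpace.word_injective (x : SymbolicSpace b) :
    Function.Injective x.word := fun m n h => by
  have := congrArg (fun u => u.1.length) h
  simpa [SymbolicSpace.word] using this

theorem iIndepFun_word (hW : IsMandelbrotCascade P W P' X) (x : SymbolicSpace b) :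
    iIndepFun (fun n => W (x.take (n + 1))) P :=
  hW.indep.precomp x.word_injective

/-- Factors along branches that avoid `S` integrate to one. -/
theorem lintegral_mul_prod_Ico (hW : IsMandelbrotCascade P W P' X)
    {S : Set {u : List (Fin b) // u ≠ []}} {F : Ω → ℝ≥0∞} (hF : Measurable[hW.weightSigma S] F)
    (y : SymbolicSpace b) {k m : ℕ} (hy : ∀ j ∈ Finset.Ico k m, y.word j ∉ S) :
    ∫⁻ ω, F ω * ∏ j ∈ Finset.Ico k m, (W (y.take (j + 1)) ω : ℝ≥0∞) ∂P = ∫⁻ ω, F ω ∂P := by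
  have hd : Disjoint S (y.word '' (Finset.Ico k m)) := by
    rw [Set.disjoint_right]
    rintro _ ⟨j, hj, rfl⟩
    exact hy j hj
  have hm : Measurable[hW.weightSigma (y.word '' (Finset.Ico k m))]
      fun ω => ∏ j ∈ Finset.Ico k m, (W (y.take (j + 1)) ω : ℝ≥0∞) := by
    refine Finset.measurable_fun_prod _ fun j hj => ?_
    exact measurable_coe_nnreal_ennreal.comp
      (hW.measurable_weightSigma (y.take_ne_nil j) ⟨j, hj, rfl⟩)
  rw [lintegral_mul_eq_lintegral_mul_lintegral_of_independent_measurableSpace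
    (hW.weightSigma_le _) (hW.weightSigma_le _) (hW.indep_weightSigma hd) hF hm,
    lintegral_prod_eq_prod_lintegral_of_indepFun _
      (fun j ω => (W (y.take (j + 1)) ω : ℝ≥0∞))
      ((hW.iIndepFun_word y).comp _ fun _ => measurable_coe_nnreal_ennreal)
      fun j => measurable_coe_nnreal_ennreal.comp (hW.measurable_take y j)]
  simp [hW.lintegral_eq_one (y.take_ne_nil _)]

theorem lintegral_cascadeDensity (hW : IsMandelbrotCascade P W P' X) [IsProbabilityMeasure P]
    (x : SymbolicSpace b) (m : ℕ) : ∫⁻ ω, (cascadeDensity W m ω x : ℝ≥0∞) ∂P = 1 := by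
  have := hW.lintegral_mul_prod_Ico (S := ∅) (F := fun _ => 1) measurable_const x (k := 0) (m := m)
    (by simp)
  simpa [cascadeDensity] using this

/-- The filtration generated by the weights of the words of length at most `n`. -/
def filtration (hW : IsMandelbrotCascade P W P' X) : Filtration ℕ ‹MeasurableSpace Ω› where
  seq n := hW.weightSigma {u | u.1.length ≤ n}
  mono' _ _ h := hW.weightSigma_mono fun _ hu => le_trans hu h
  le' _ := hW.weightSigma_le _

theorem measurable_filtration_cascadeDensity (hW : IsMandelbrotCascade P W P' X)
    (x : SymbolicSpace b) (n : ℕ) : Measurable[hW.filtration n] fun ω => cascadeDensity W n ω x :=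
  Finset.measurable_fun_prod _ fun k hk =>
    hW.measurable_weightSigma (x.take_ne_nil k) (by simpa using Finset.mem_range.1 hk)

theorem measurable_uncurry_cascadeDensity [NeZero b] (hW : IsMandelbrotCascade P W P' X) (n : ℕ) :
    Measurable (Function.uncurry fun ω x => (cascadeDensity W n ω x : ℝ≥0∞)) :=
  SymbolicSpace.measurable_uncurry_of_cylinder n
    (fun ω _ _ h => by rw [cascadeDensity_congr W ω h le_rfl])
    fun x => (hW.measurable_cascadeDensity x n).coe_nnreal_ennreal

variable {ν : Measure (SymbolicSpace b)} [IsProbabilityMeasure ν]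

theorem measurable_filtration_cascadeMeasure [NeZero b] (hW : IsMandelbrotCascade P W P' X)
    {s : Set (SymbolicSpace b)} (hs : MeasurableSet s) (n : ℕ) :
    Measurable[hW.filtration n]
      fun ω => (cascadeMeasure W ν n ω : Measure (SymbolicSpace b)) s := by
  simp_rw [cascadeMeasure_apply W ν n _ hs]
  refine @Measurable.lintegral_prod_right' Ω _ (hW.filtration n) _ _ _
    (fun p => (cascadeDensity W n p.1 p.2 : ℝ≥0∞)) ?_
  exact SymbolicSpace.measurable_uncurry_of_cylinder (mΩ := hW.filtration n)
    (F := fun ω x => (cascadeDensity W n ω x : ℝ≥0∞)) n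
    (fun ω _ _ h => by rw [cascadeDensity_congr W ω h le_rfl])
    fun x => (hW.measurable_filtration_cascadeDensity x n).coe_nnreal_ennreal

theorem measurable_cascadeMeasure [NeZero b] (hW : IsMandelbrotCascade P W P' X)
    {s : Set (SymbolicSpace b)} (hs : MeasurableSet s) (n : ℕ) :
    Measurable fun ω => (cascadeMeasure W ν n ω : Measure (SymbolicSpace b)) s :=
  (hW.measurable_filtration_cascadeMeasure hs n).mono (hW.filtration.le n) le_rfl

variable [IsProbabilityMeasure P]

theorem lintegral_cascadeMeasure_apply [NeZero b] (hW : IsMandelbrotCascade P W P' X)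
    {s : Set (SymbolicSpace b)} (hs : MeasurableSet s) (n : ℕ) :
    ∫⁻ ω, (cascadeMeasure W ν n ω : Measure (SymbolicSpace b)) s ∂P = ν s := by
  simp_rw [cascadeMeasure_apply W ν n _ hs]
  rw [lintegral_lintegral_swap (hW.measurable_uncurry_cascadeDensity n).aemeasurable]
  simp [hW.lintegral_cascadeDensity]

/-- The martingale property: by Tonelli it can be checked for each `x`, where the new factor is
independent of the past and has mean one. -/
theorem setLIntegral_cascadeMeasure_succ [NeZero b] (hW : IsMandelbrotCascade P W P' X)
    {s : Set (SymbolicSpace b)} (hs : MeasurableSet s) (n : ℕ) {A : Set Ω}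
    (hA : MeasurableSet[hW.filtration n] A) :
    ∫⁻ ω in A, (cascadeMeasure W ν n ω : Measure (SymbolicSpace b)) s ∂P =
      ∫⁻ ω in A, (cascadeMeasure W ν (n + 1) ω : Measure (SymbolicSpace b)) s ∂P := by
  simp_rw [cascadeMeasure_apply W ν _ _ hs]
  rw [lintegral_lintegral_swap (hW.measurable_uncurry_cascadeDensity n).aemeasurable,
    lintegral_lintegral_swap (hW.measurable_uncurry_cascadeDensity (n + 1)).aemeasurable]
  congr 1 with x
  have hA' := hW.filtration.le n _ hA
  rw [← lintegral_indicator hA', ← lintegral_indicator hA']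
  have h := hW.lintegral_mul_prod_Ico (S := {u | u.1.length ≤ n})
    (F := A.indicator fun ω => (cascadeDensity W n ω x : ℝ≥0∞))
    (Measurable.indicator (hW.measurable_filtration_cascadeDensity x n).coe_nnreal_ennreal hA)
    x (k := n) (m := n + 1) (by simp [SymbolicSpace.word])
  rw [← h]
  congr 1 with ω
  by_cases hω : ω ∈ A <;> simp [hω, cascadeDensity_succ]

theorem ae_tendsto_cascadeMeasure_apply [NeZero b] (hW : IsMandelbrotCascade P W P' X)
    {s : Set (SymbolicSpace b)} (hs : MeasurableSet s) :
    ∀ᵐ ω ∂P, ∃ a, Tendsto (fun n => cascadeMeasure W ν n ω s) atTop (𝓝 a) := by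
  let f : ℕ → Ω → ℝ := fun n ω => ((cascadeMeasure W ν n ω : Measure (SymbolicSpace b)) s).toReal
  have hint : ∀ n, Integrable (f n) P := fun n =>
    integrable_toReal_of_lintegral_ne_top (hW.measurable_cascadeMeasure hs n).aemeasurable
      (by rw [hW.lintegral_cascadeMeasure_apply hs]; exact measure_ne_top _ _)
  have hmart : Martingale f hW.filtration P := by
    refine martingale_of_setIntegral_eq_succ
      (fun n => (hW.measurable_filtration_cascadeMeasure hs n).ennreal_toReal.stronglyMeasurable)
      hint fun n A hA => ?_
    rw [integral_toReal (hW.measurable_cascadeMeasure hs _).aemeasurable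
        (ae_of_all _ fun ω => measure_lt_top _ _),
      integral_toReal (hW.measurable_cascadeMeasure hs _).aemeasurable
        (ae_of_all _ fun ω => measure_lt_top _ _), hW.setLIntegral_cascadeMeasure_succ hs n hA]
  have hbdd : ∀ n, eLpNorm (f n) 1 P ≤ (1 : ℝ≥0) := fun n => by
    rw [eLpNorm_one_eq_lintegral_enorm]
    calc ∫⁻ ω, ‖f n ω‖ₑ ∂P
        = ∫⁻ ω, (cascadeMeasure W ν n ω : Measure (SymbolicSpace b)) s ∂P := by
          congr 1 with ω
          rw [Real.enorm_of_nonneg ENNReal.toReal_nonneg, ENNReal.ofReal_toReal (measure_ne_top _ _)]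
      _ ≤ 1 := by rw [hW.lintegral_cascadeMeasure_apply hs]; exact prob_le_one
  filter_upwards [hmart.submartingale.ae_tendsto_limitProcess hbdd] with ω hω
  exact ⟨_, (continuous_real_toNNReal.tendsto _).comp hω |>.congr fun n => Real.toNNReal_coe⟩

theorem ae_tendsto_cascadeLimit [NeZero b] (hW : IsMandelbrotCascade P W P' X) :
    ∀ᵐ ω ∂P, Tendsto (fun n => cascadeMeasure W ν n ω) atTop (𝓝 (cascadeLimit W ν ω)) := by
  have h : ∀ᵐ ω ∂P, ∀ k (v : Fin k → Fin b), ∃ a, Tendsto (fun n => cascadeMeasure W ν n ω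
      (PiNat.cylinder (SymbolicSpace.extend k v) k)) atTop (𝓝 a) := by
    rw [ae_all_iff]
    intro k
    rw [ae_all_iff]
    intro v
    exact hW.ae_tendsto_cascadeMeasure_apply (SymbolicSpace.isClopen_cylinder _ _).isOpen.measurableSet
  filter_upwards [h] with ω hω
  refine tendsto_nhds_limUnder (SymbolicSpace.exists_tendsto_of_cylinder fun x n => ?_)
  rw [PiNat.mem_cylinder_iff_eq.1 (SymbolicSpace.mem_cylinder_extend n x)]
  exact hω n _

end IsMandelbrotCascade

section DecayInterval

theorem mul_mem_decayInterval {c c' ε ε' : ℝ} {k : ℕ} {a a' : ℝ≥0∞} (h : a ∈ decayInterval c ε k)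
    (h' : a' ∈ decayInterval c' ε' k) : a * a' ∈ decayInterval (c + c') (ε + ε') k := by
  constructor
  · refine le_trans (le_of_eq ?_) (mul_le_mul' h.1 h'.1)
    rw [← ENNReal.ofReal_mul (Real.exp_pos _).le, ← Real.exp_add]
    ring_nf
  · refine le_trans (mul_le_mul' h.2 h'.2) (le_of_eq ?_)
    rw [← ENNReal.ofReal_mul (Real.exp_pos _).le, ← Real.exp_add]
    ring_nf

end DecayInterval

/-! ### The size-biased law and the law of large numbers. -/

section Entropy

variable {Ω' : Type*} [MeasurableSpace Ω'] {P' : Measure Ω'} {X : Ω' → ℝ≥0}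

theorem neg_mul_log_le_one {t : ℝ} (ht : 0 ≤ t) : -(t * Real.log t) ≤ 1 := by
  rcases ht.eq_or_lt with rfl | ht
  · simp
  · have h := mul_le_mul_of_nonneg_left (Real.one_sub_inv_le_log_of_pos ht) ht.le
    rw [mul_sub, mul_inv_cancel₀ ht.ne'] at h
    linarith

/-- The negative part of `X log X` is bounded, so a failure of integrability would make the entropy
`⊤`, against `hD`. -/
theorem integrable_mul_log_of_entropyXLogX_lt [IsProbabilityMeasure P'] (hX : AEMeasurable X P') {D : ℝ}
    (hD : entropyXLogX P' X < (D : EReal)) :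
    Integrable (fun ω => (X ω : ℝ) * Real.log (X ω)) P' ∧
      entropyXLogX P' X = ((∫ ω, (X ω : ℝ) * Real.log (X ω) ∂P' : ℝ) : EReal) := by
  have hneg : ∫⁻ ω, ENNReal.ofReal (-((X ω : ℝ) * Real.log (X ω))) ∂P' ≠ ∞ := by
    refine ne_top_of_le_ne_top ENNReal.one_ne_top
      ((lintegral_mono (g := fun _ => 1) fun ω => ?_).trans_eq (by simp))
    exact ENNReal.ofReal_le_one.2 (neg_mul_log_le_one (X ω).2)
  have hpos : ∫⁻ ω, ENNReal.ofReal ((X ω : ℝ) * Real.log (X ω)) ∂P' ≠ ∞ := by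
    intro h
    rw [entropyXLogX, h, ← ENNReal.ofReal_toReal hneg] at hD
    simp at hD
  have hm : AEMeasurable (fun ω => (X ω : ℝ) * Real.log (X ω)) P' := by fun_prop
  have hint : Integrable (fun ω => (X ω : ℝ) * Real.log (X ω)) P' := by
    refine ⟨hm.aestronglyMeasurable, ?_⟩
    rw [hasFiniteIntegral_iff_enorm]
    calc ∫⁻ ω, ‖(X ω : ℝ) * Real.log (X ω)‖ₑ ∂P'
        ≤ ∫⁻ ω, (ENNReal.ofReal ((X ω : ℝ) * Real.log (X ω)) +
            ENNReal.ofReal (-((X ω : ℝ) * Real.log (X ω)))) ∂P' := by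
          refine lintegral_mono fun ω => ?_
          rw [Real.enorm_eq_ofReal_abs]
          rcases abs_cases ((X ω : ℝ) * Real.log (X ω)) with h | h <;> rw [h.1] <;> simp
      _ < ∞ := by
          rw [lintegral_add_left' hm.ennreal_ofReal]
          exact ENNReal.add_lt_top.2 ⟨hpos.lt_top, hneg.lt_top⟩
  refine ⟨hint, ?_⟩
  rw [integral_eq_lintegral_pos_part_sub_lintegral_neg_part hint, entropyXLogX, EReal.coe_sub,
    EReal.coe_ennreal_toReal hpos, EReal.coe_ennreal_toReal hneg]

/-- The size-biased law `t λ(dt)`, where `λ` is the law of `X`. -/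
noncomputable def sizeBiasedLaw (P' : Measure Ω') (X : Ω' → ℝ≥0) : Measure ℝ≥0 :=
  (P'.map X).withDensity fun t => (t : ℝ≥0∞)

theorem isProbabilityMeasure_sizeBiasedLaw (hX : AEMeasurable X P')
    (h1 : ∫⁻ ω, (X ω : ℝ≥0∞) ∂P' = 1) : IsProbabilityMeasure (sizeBiasedLaw P' X) := by
  constructor
  rw [sizeBiasedLaw, withDensity_apply _ MeasurableSet.univ, Measure.restrict_univ,
    lintegral_map' (by fun_prop) hX, h1]

theorem ae_sizeBiasedLaw_ne_zero : ∀ᵐ t ∂(sizeBiasedLaw P' X), t ≠ 0 := by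
  rw [sizeBiasedLaw, ae_withDensity_iff (by fun_prop)]
  exact ae_of_all _ fun t ht => by simpa using ht

theorem integrable_log_sizeBiasedLaw (hX : AEMeasurable X P')
    (hint : Integrable (fun ω => (X ω : ℝ) * Real.log (X ω)) P') :
    Integrable (fun t : ℝ≥0 => Real.log t) (sizeBiasedLaw P' X) ∧
      ∫ t : ℝ≥0, Real.log t ∂(sizeBiasedLaw P' X) = ∫ ω, (X ω : ℝ) * Real.log (X ω) ∂P' := by
  have hm : Measurable fun t : ℝ≥0 => t • Real.log t := by
    simp only [NNReal.smul_def, smul_eq_mul]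
    fun_prop
  constructor
  · rw [sizeBiasedLaw, integrable_withDensity_iff_integrable_smul measurable_id',
      integrable_map_measure hm.aestronglyMeasurable hX]
    exact hint
  · rw [sizeBiasedLaw, integral_withDensity_eq_integral_smul measurable_id',
      integral_map hX hm.aestronglyMeasurable]
    rfl

/-- The strong law for `log t_j`, whose mean is `E(X log X)`. The centre carries a minus sign
because `decayInterval` measures decay. -/
theorem ae_eventually_prod_mem_decayInterval (hX : AEMeasurable X P')
    (h1 : ∫⁻ ω, (X ω : ℝ≥0∞) ∂P' = 1)
    (hint : Integrable (fun ω => (X ω : ℝ) * Real.log (X ω)) P') {ε : ℝ} (hε : 0 < ε) :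
    ∀ᵐ t ∂(Measure.infinitePi fun _ : ℕ => sizeBiasedLaw P' X), ∀ᶠ k in atTop,
      ((∏ j ∈ Finset.range k, t j : ℝ≥0) : ℝ≥0∞) ∈
        decayInterval (-∫ ω, (X ω : ℝ) * Real.log (X ω) ∂P') ε k := by
  have := isProbabilityMeasure_sizeBiasedLaw hX h1
  obtain ⟨hlog, hmean⟩ := integrable_log_sizeBiasedLaw hX hint
  have hml : Measurable fun t : ℝ≥0 => Real.log t := by fun_prop
  have hev : ∀ i : ℕ, (Measure.infinitePi fun _ : ℕ => sizeBiasedLaw P' X).map (fun t => t i) =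
      sizeBiasedLaw P' X := fun i => Measure.infinitePi_map_eval _ i
  have hlln := strong_law_ae_real (μ := Measure.infinitePi fun _ : ℕ => sizeBiasedLaw P' X)
    (fun j t => Real.log (t j))
    (by
      have h := integrable_map_measure (μ := Measure.infinitePi fun _ : ℕ => sizeBiasedLaw P' X)
        (f := fun t => t 0) (g := fun t : ℝ≥0 => Real.log t)
        hml.aestronglyMeasurable (measurable_pi_apply 0).aemeasurable
      rw [hev 0] at h
      exact h.1 hlog)
    (fun i j hij => (iIndepFun_infinitePi (P := fun _ : ℕ => sizeBiasedLaw P' X)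
      (X := fun _ (t : ℝ≥0) => Real.log t) fun _ => hml).indepFun hij)
    (fun i => IdentDistrib.comp (u := fun t : ℝ≥0 => Real.log t)
      ⟨(measurable_pi_apply i).aemeasurable, (measurable_pi_apply 0).aemeasurable, by
        rw [hev, hev]⟩ hml)
  have hE : ∫ t, Real.log (t 0) ∂(Measure.infinitePi fun _ : ℕ => sizeBiasedLaw P' X) =
      ∫ ω, (X ω : ℝ) * Real.log (X ω) ∂P' := by
    rw [← hmean, ← hev 0, integral_map (measurable_pi_apply 0).aemeasurable (by rw [hev 0]; exact hml.aestronglyMeasurable),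
      hev 0]
  -- As `Real.log 0 = 0`, the product is the exponential of the sum of logarithms only when no
  -- factor vanishes.
  have hne : ∀ᵐ t ∂(Measure.infinitePi fun _ : ℕ => sizeBiasedLaw P' X), ∀ j, t j ≠ 0 := by
    rw [ae_all_iff]
    intro j
    have h := ae_sizeBiasedLaw_ne_zero (P' := P') (X := X)
    rw [← hev j] at h
    exact ae_of_ae_map (p := fun t => t ≠ 0) (measurable_pi_apply j).aemeasurable h
  filter_upwards [hlln, hne] with t ht hne
  rw [hE] at ht
  set h := ∫ ω, (X ω : ℝ) * Real.log (X ω) ∂P'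
  filter_upwards [ht.eventually (lt_mem_nhds (sub_lt_self h hε)),
    ht.eventually (gt_mem_nhds (lt_add_of_pos_right h hε)), eventually_gt_atTop 0] with k h₁ h₂ hk
  have hk' : (0 : ℝ) < k := by exact_mod_cast hk
  have hprod : ((∏ j ∈ Finset.range k, t j : ℝ≥0) : ℝ≥0∞) =
      ENNReal.ofReal (Real.exp (∑ j ∈ Finset.range k, Real.log (t j))) := by
    rw [Real.exp_sum, ← ENNReal.ofReal_coe_nnreal]
    congr 1
    push_cast
    exact Finset.prod_congr rfl fun j _ => (Real.exp_log (by exact_mod_cast (hne j).bot_lt)).symm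
  rw [lt_div_iff₀ hk'] at h₁
  rw [div_lt_iff₀ hk'] at h₂
  rw [hprod]
  constructor <;> refine ENNReal.ofReal_le_ofReal (Real.exp_le_exp.2 ?_) <;> nlinarith

end Entropy

/-! ### Weights along a fixed branch, and points that leave it. -/

namespace IsMandelbrotCascade

variable {b : ℕ} {Ω Ω' : Type*} [MeasurableSpace Ω] [MeasurableSpace Ω'] {P : Measure Ω}
  {P' : Measure Ω'} {W : List (Fin b) → Ω → ℝ≥0} {X : Ω' → ℝ≥0}

theorem aemeasurable [NeZero b] (hW : IsMandelbrotCascade P W P' X) : AEMeasurable X P' :=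
  (hW.identDistrib [0] (by simp)).aemeasurable_snd

/-- On a box, density and indicator together are a product of functions of single independent
weights, and each factor integrates to the size-biased mass of a side. -/
theorem map_withDensity_eq_pi [NeZero b] (hW : IsMandelbrotCascade P W P' X)
    (x : SymbolicSpace b) (I : Finset ℕ) :
    (P.withDensity fun ω => ∏ j ∈ I, (W (x.take (j + 1)) ω : ℝ≥0∞)).map
      (fun ω (j : I) => W (x.take (j + 1)) ω) = Measure.pi fun _ => sizeBiasedLaw P' X := by
  have := isProbabilityMeasure_sizeBiasedLaw hW.aemeasurable hW.mean_one
  have hmY : Measurable fun ω (j : I) => W (x.take (j + 1)) ω :=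
    measurable_pi_lambda _ fun j => hW.measurable_take x j
  refine (Measure.pi_eq fun s hs => ?_).symm
  have hpre : MeasurableSet ((fun ω (j : I) => W (x.take (j + 1)) ω) ⁻¹' Set.univ.pi s) :=
    hmY (MeasurableSet.univ_pi hs)
  have hms : ∀ j : I, Measurable ((s j).indicator fun t : ℝ≥0 => (t : ℝ≥0∞)) := fun j =>
    measurable_coe_nnreal_ennreal.indicator (hs j)
  rw [Measure.map_apply hmY (MeasurableSet.univ_pi hs), withDensity_apply _ hpre,
    ← lintegral_indicator hpre]
  have hprod : ∀ ω, ((fun ω (j : I) => W (x.take (j + 1)) ω) ⁻¹' Set.univ.pi s).indicator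
      (fun ω => ∏ j ∈ I, (W (x.take (j + 1)) ω : ℝ≥0∞)) ω =
      ∏ j : I, (s j).indicator (fun t : ℝ≥0 => (t : ℝ≥0∞)) (W (x.take (j + 1)) ω) := fun ω => by
    by_cases h : ω ∈ (fun ω (j : I) => W (x.take (j + 1)) ω) ⁻¹' Set.univ.pi s
    · rw [Set.indicator_of_mem h, ← Finset.prod_coe_sort]
      refine Finset.prod_congr rfl fun j _ => ?_
      rw [Set.indicator_of_mem (h j (Set.mem_univ j))]
    · rw [Set.indicator_of_notMem h]
      simp only [Set.mem_preimage, Set.mem_univ_pi, not_forall] at h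
      obtain ⟨j, hj⟩ := h
      exact (Finset.prod_eq_zero (Finset.mem_univ j) (Set.indicator_of_notMem hj _)).symm
  simp_rw [hprod]
  rw [lintegral_prod_eq_prod_lintegral_of_indepFun Finset.univ
    (fun (j : I) ω => (s j).indicator (fun t : ℝ≥0 => (t : ℝ≥0∞)) (W (x.take (j + 1)) ω))
    (((hW.iIndepFun_word x).precomp (g := fun j : I => (j : ℕ)) Subtype.val_injective).comp
      (fun j => (s j).indicator fun t : ℝ≥0 => (t : ℝ≥0∞)) hms)
    fun j => (hms j).comp (hW.measurable_take x j)]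
  refine Finset.prod_congr rfl fun j _ => ?_
  rw [sizeBiasedLaw, withDensity_apply _ (hs j), ← lintegral_indicator (hs j),
    ← (hW.identDistrib _ (x.take_ne_nil j)).map_eq, lintegral_map (hms j) (hW.measurable_take x j)]

/-- Under the law with density `Q_m(x)`, the weights along `x` up to level `m` are independent
with the size-biased law. -/
theorem lintegral_cascadeDensity_mul_indicator [NeZero b] (hW : IsMandelbrotCascade P W P' X)
    (x : SymbolicSpace b) (m : ℕ) {E : Set (ℕ → ℝ≥0)} (hE : MeasurableSet E)
    (hEm : ∀ s t : ℕ → ℝ≥0, (∀ i < m, s i = t i) → s ∈ E → t ∈ E) :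
    ∫⁻ ω, cascadeDensity W m ω x *
        E.indicator (1 : (ℕ → ℝ≥0) → ℝ≥0∞) (fun j => W (x.take (j + 1)) ω) ∂P =
      Measure.infinitePi (fun _ : ℕ => sizeBiasedLaw P' X) E := by
  have := isProbabilityMeasure_sizeBiasedLaw hW.aemeasurable hW.mean_one
  let I := Finset.range m
  let e : (I → ℝ≥0) → ℕ → ℝ≥0 := fun v i => if h : i ∈ I then v ⟨i, h⟩ else 0
  have he : Measurable e := measurable_pi_lambda _ fun i => by
    by_cases h : i ∈ I
    · simp only [e, h, dite_true]; fun_prop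
    · simp only [e, h, dite_false]; fun_prop
  have hiff : ∀ t : ℕ → ℝ≥0, t ∈ E ↔ e (I.restrict t) ∈ E := fun t => by
    have h : ∀ i < m, t i = e (I.restrict t) i := fun i hi => by
      simp [e, I, hi]
    exact ⟨hEm _ _ h, hEm _ _ fun i hi => (h i hi).symm⟩
  have hmY : Measurable fun ω (j : I) => W (x.take (j + 1)) ω :=
    measurable_pi_lambda _ fun j => hW.measurable_take x j
  have hmY' : Measurable fun ω (j : ℕ) => W (x.take (j + 1)) ω :=
    measurable_pi_lambda _ fun j => hW.measurable_take x j
  -- `E` depends only on the first `m` coordinates, so only the marginal of the infinite product on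
  -- `I` matters; `e` pads with zeros.
  have hEq : E = I.restrict ⁻¹' (e ⁻¹' E) := Set.ext hiff
  conv_rhs => rw [hEq, ← Measure.map_apply (by fun_prop) (he hE), Measure.infinitePi_map_restrict,
    ← hW.map_withDensity_eq_pi x I, Measure.map_apply hmY (he hE),
    withDensity_apply _ (hmY (he hE)), ← lintegral_indicator (hmY (he hE))]
  refine lintegral_congr fun ω => ?_
  have hd : (cascadeDensity W m ω x : ℝ≥0∞) = ∏ j ∈ I, (W (x.take (j + 1)) ω : ℝ≥0∞) := by
    simp [cascadeDensity, I]
  rw [hd]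
  by_cases h : (fun j => W (x.take (j + 1)) ω) ∈ E
  · have h' := (hiff _).1 h
    rw [Set.indicator_of_mem h, Set.indicator_of_mem (by exact h')]
    simp
  · have h' := fun h' => h ((hiff _).2 h')
    rw [Set.indicator_of_notMem h, Set.indicator_of_notMem (by exact h')]
    simp

/-- If `y` branches off `x` at level `k`, the factors of `Q_m(y)` beyond level `k` integrate out. -/
theorem lintegral_mul_cascadeDensity_of_branch (hW : IsMandelbrotCascade P W P' X)
    {x y : SymbolicSpace b} {F : Ω → ℝ≥0∞} (hF : Measurable[hW.weightSigma (Set.range x.word)] F)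
    {k m : ℕ} (hkm : k ≤ m) (hk : y ∈ PiNat.cylinder x k) (hk' : y ∉ PiNat.cylinder x (k + 1)) :
    ∫⁻ ω, F ω * cascadeDensity W m ω y ∂P = ∫⁻ ω, F ω * cascadeDensity W k ω x ∂P := by
  have hQ : Measurable[hW.weightSigma (Set.range x.word)] fun ω => cascadeDensity W k ω x :=
    Finset.measurable_fun_prod _ fun j _ => hW.measurable_weightSigma (x.take_ne_nil j) ⟨j, rfl⟩
  rw [← hW.lintegral_mul_prod_Ico (F := fun ω => F ω * cascadeDensity W k ω x)
    (Measurable.mul hF hQ.coe_nnreal_ennreal) y (k := k) (m := m)]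
  · refine lintegral_congr fun ω => ?_
    rw [cascadeDensity_eq_mul_prod_Ico W hkm, cascadeDensity_congr W ω hk le_rfl]
    push_cast
    ring
  -- A prefix of `y` longer than `k` that is also a prefix of `x` would put `y` in the level-`(k +
  -- 1)` cylinder of `x`.
  · rintro j hj ⟨i, hi⟩
    have hij : x.take (i + 1) = y.take (j + 1) := congrArg Subtype.val hi
    have hlen : i = j := by simpa using congrArg List.length hij
    subst hlen
    exact hk' (PiNat.cylinder_anti x (by simp at hj; omega)
      (SymbolicSpace.mem_cylinder_of_take_eq hij.symm))

variable [IsProbabilityMeasure P] {ν : Measure (SymbolicSpace b)} [IsProbabilityMeasure ν]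

/-- Each `y` in the cylinder is sorted by the level `k` at which it leaves `x`, with `k = m` if it
agrees with `x` up to level `m`. The bound arises by enlarging each such shell to the whole cylinder
`[x|_k]`. -/
theorem lintegral_mul_cascadeMeasure_cylinder_le [NeZero b] (hW : IsMandelbrotCascade P W P' X)
    {x : SymbolicSpace b} {F : Ω → ℝ≥0∞} (hF : Measurable[hW.weightSigma (Set.range x.word)] F)
    {n m : ℕ} (hnm : n ≤ m) :
    ∫⁻ ω, F ω * (cascadeMeasure W ν m ω : Measure (SymbolicSpace b)) (PiNat.cylinder x n) ∂P ≤
      ∑ k ∈ Finset.Icc n m, ν (PiNat.cylinder x k) * ∫⁻ ω, F ω * cascadeDensity W k ω x ∂P := by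
  have hcm : ∀ k, MeasurableSet (PiNat.cylinder x k) := fun k =>
    (SymbolicSpace.isClopen_cylinder x k).isOpen.measurableSet
  have hF' : Measurable F := Measurable.mono hF (hW.weightSigma_le _) le_rfl
  have hFQ : Measurable (Function.uncurry fun ω y => F ω * (cascadeDensity W m ω y : ℝ≥0∞)) :=
    (hF'.comp measurable_fst).mul (hW.measurable_uncurry_cascadeDensity m)
  have hpt : ∀ y ∈ PiNat.cylinder x n, ∫⁻ ω, F ω * cascadeDensity W m ω y ∂P ≤
      ∑ k ∈ Finset.Icc n m, (PiNat.cylinder x k).indicator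
        (fun _ => ∫⁻ ω, F ω * cascadeDensity W k ω x ∂P) y := by
    intro y hy
    obtain ⟨k, hk, hyk, heq⟩ : ∃ k ∈ Finset.Icc n m, y ∈ PiNat.cylinder x k ∧
        ∫⁻ ω, F ω * cascadeDensity W m ω y ∂P = ∫⁻ ω, F ω * cascadeDensity W k ω x ∂P := by
      by_cases h : ∃ k, n ≤ k ∧ k < m ∧ y ∈ PiNat.cylinder x k ∧ y ∉ PiNat.cylinder x (k + 1)
      · obtain ⟨k, hnk, hkm, hk, hk'⟩ := h
        exact ⟨k, Finset.mem_Icc.2 ⟨hnk, hkm.le⟩, hk,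
          hW.lintegral_mul_cascadeDensity_of_branch hF hkm.le hk hk'⟩
      · have hall : ∀ k, n ≤ k → k ≤ m → y ∈ PiNat.cylinder x k := fun k hnk =>
          Nat.le_induction (fun _ => hy) (fun k hk ih hkm => by
            by_contra hc
            exact h ⟨k, hk, hkm, ih (by omega), hc⟩) k hnk
        have hm := hall m hnm le_rfl
        refine ⟨m, Finset.mem_Icc.2 ⟨hnm, le_rfl⟩, hm, ?_⟩
        simp_rw [cascadeDensity_congr W _ hm le_rfl]
    rw [heq]
    refine le_trans (le_of_eq ?_) (Finset.single_le_sum (fun _ _ => zero_le) hk)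
    rw [Set.indicator_of_mem hyk]
  simp_rw [cascadeMeasure_apply W ν m _ (hcm n)]
  calc ∫⁻ ω, F ω * ∫⁻ y in PiNat.cylinder x n, cascadeDensity W m ω y ∂ν ∂P
      = ∫⁻ ω, ∫⁻ y in PiNat.cylinder x n, F ω * cascadeDensity W m ω y ∂ν ∂P := by
        refine lintegral_congr fun ω => ?_
        rw [lintegral_const_mul _ (_root_.measurable_cascadeDensity W m ω)]
    _ = ∫⁻ y in PiNat.cylinder x n, ∫⁻ ω, F ω * cascadeDensity W m ω y ∂P ∂ν :=
        lintegral_lintegral_swap hFQ.aemeasurable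
    _ ≤ ∫⁻ y in PiNat.cylinder x n, ∑ k ∈ Finset.Icc n m, (PiNat.cylinder x k).indicator
        (fun _ => ∫⁻ ω, F ω * cascadeDensity W k ω x ∂P) y ∂ν :=
        setLIntegral_mono' (hcm n) hpt
    _ ≤ ∫⁻ y, ∑ k ∈ Finset.Icc n m, (PiNat.cylinder x k).indicator
        (fun _ => ∫⁻ ω, F ω * cascadeDensity W k ω x ∂P) y ∂ν := setLIntegral_le_lintegral _ _
    _ = _ := by
        rw [lintegral_finsetSum _ fun k _ => measurable_const.indicator (hcm k)]
        refine Finset.sum_congr rfl fun k _ => ?_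
        rw [lintegral_indicator_const (hcm k), mul_comm]

end IsMandelbrotCascade

/-! ### Irregular points and estimates under the Peyrière measure, uniform in `m`. -/

theorem tendsto_measure_exists_ge_of_ae_eventually {α : Type*} [MeasurableSpace α] {μ : Measure α}
    [IsFiniteMeasure μ] {p : ℕ → α → Prop} (hm : ∀ k, MeasurableSet {x | p k x})
    (h : ∀ᵐ x ∂μ, ∀ᶠ k in atTop, p k x) :
    Tendsto (fun N => μ {x | ∃ k, N ≤ k ∧ ¬ p k x}) atTop (𝓝 0) := by
  have hms : ∀ N, MeasurableSet {x | ∃ k, N ≤ k ∧ ¬ p k x} := fun N => by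
    have : {x | ∃ k, N ≤ k ∧ ¬ p k x} = ⋃ k, ⋃ _ : N ≤ k, {x | p k x}ᶜ := by ext; simp
    rw [this]
    exact .iUnion fun k => .iUnion fun _ => (hm k).compl
  have ht := tendsto_measure_iInter_atTop (μ := μ) (s := fun N => {x | ∃ k, N ≤ k ∧ ¬ p k x})
    (fun N => (hms N).nullMeasurableSet)
    (fun N N' hN x ⟨k, hk, hx⟩ => ⟨k, hN.trans hk, hx⟩) ⟨0, measure_ne_top _ _⟩
  have h0 : μ (⋂ N, {x | ∃ k, N ≤ k ∧ ¬ p k x}) = 0 := by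
    refine measure_mono_null (fun x hx => ?_) h
    intro hx'
    obtain ⟨N, hN⟩ := eventually_atTop.1 hx'
    obtain ⟨k, hk, hkx⟩ := Set.mem_iInter.1 hx N
    exact hkx (hN k hk)
  rwa [h0] at ht

/-- For `q ≥ 1` the truncated subtraction makes the right side infinite. -/
theorem ENNReal.sum_Icc_pow_le (q : ℝ≥0∞) (k m : ℕ) :
    ∑ j ∈ Finset.Icc k m, q ^ j ≤ (1 - q)⁻¹ * q ^ k := by
  calc ∑ j ∈ Finset.Icc k m, q ^ j
      ≤ ∑ j ∈ (Finset.range (m + 1)).image (k + ·), q ^ j := by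
        refine Finset.sum_le_sum_of_subset fun j hj => ?_
        simp only [Finset.mem_Icc, Finset.mem_image, Finset.mem_range] at hj ⊢
        exact ⟨j - k, by omega, by omega⟩
    _ = ∑ i ∈ Finset.range (m + 1), q ^ i * q ^ k := by
        rw [Finset.sum_image (by simp)]
        exact Finset.sum_congr rfl fun i _ => by rw [pow_add, mul_comm]
    _ ≤ (∑' i, q ^ i) * q ^ k := by
        rw [← Finset.sum_mul]
        exact mul_le_mul_left (ENNReal.sum_le_tsum _) _
    _ = _ := by rw [ENNReal.tsum_geometric]

theorem ENNReal.ofReal_exp_neg_natCast_mul (k : ℕ) (a : ℝ) :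
    ENNReal.ofReal (Real.exp (-(k * a))) = ENNReal.ofReal (Real.exp (-a)) ^ k := by
  rw [← ENNReal.ofReal_pow (Real.exp_pos _).le, ← Real.exp_nat_mul]
  ring_nf

theorem ENNReal.ofReal_exp_neg_lt_one {a : ℝ} (ha : 0 < a) :
    ENNReal.ofReal (Real.exp (-a)) < 1 := by
  rw [ENNReal.ofReal_lt_one, Real.exp_lt_one_iff]
  linarith

/-- The points at which the mass of some cylinder of level between `N` and `M` is off the
expected decay `exp (-k c)` by more than a factor `exp (k ε)`. -/
def irregularSet {b : ℕ} (ρ : Measure (SymbolicSpace b)) (c ε : ℝ) (N M : ℕ) :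
    Set (SymbolicSpace b) :=
  {x | ∃ k, N ≤ k ∧ k ≤ M ∧ ρ (PiNat.cylinder x k) ∉ decayInterval c ε k}

theorem mem_irregularSet_of_mem_cylinder {b : ℕ} {ρ : Measure (SymbolicSpace b)} {c ε : ℝ}
    {N M : ℕ} {x y : SymbolicSpace b} (h : y ∈ PiNat.cylinder x M) (hx : x ∈ irregularSet ρ c ε N M) :
    y ∈ irregularSet ρ c ε N M := by
  obtain ⟨k, hk, hkM, hkx⟩ := hx
  refine ⟨k, hk, hkM, ?_⟩
  rwa [PiNat.mem_cylinder_iff_eq.1 (PiNat.cylinder_anti x hkM h)]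

theorem isClopen_irregularSet {b : ℕ} (ρ : Measure (SymbolicSpace b)) (c ε : ℝ) (N M : ℕ) :
    IsClopen (irregularSet ρ c ε N M) :=
  SymbolicSpace.isClopen_of_cylinder fun _ _ h hx => mem_irregularSet_of_mem_cylinder h hx

section Peyriere

variable {b : ℕ} {Ω : Type*} [MeasurableSpace Ω]

/-- The measure on `Ω × Σ` with density `Q_m(ω, x)` with respect to `P ⊗ ν`. -/
noncomputable def peyriereMeasure (P : Measure Ω) (W : List (Fin b) → Ω → ℝ≥0)
    (ν : Measure (SymbolicSpace b)) (m : ℕ) : Measure (Ω × SymbolicSpace b) :=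
  (P.prod ν).withDensity fun p => (cascadeDensity W m p.1 p.2 : ℝ≥0∞)

/-- The pairs `(ω, x)` for which `Q_k(ω, x) ν([x|_k])` is off the expected decay for some `k`
between `N` and `m`. -/
def irregularDensitySet (W : List (Fin b) → Ω → ℝ≥0) (ν : Measure (SymbolicSpace b)) (c ε : ℝ)
    (N m : ℕ) : Set (Ω × SymbolicSpace b) :=
  {p | ∃ k, N ≤ k ∧ k ≤ m ∧
    (cascadeDensity W k p.1 p.2 : ℝ≥0∞) * ν (PiNat.cylinder p.2 k) ∉ decayInterval c ε k}

end Peyriere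

theorem SymbolicSpace.measurable_measure_cylinder {b : ℕ} [NeZero b]
    (ν : Measure (SymbolicSpace b)) (k : ℕ) : Measurable fun x => ν (PiNat.cylinder x k) :=
  measurable_of_cylinder k fun x y h => by rw [PiNat.mem_cylinder_iff_eq.1 h]

theorem SymbolicSpace.measurable_prod_mul_measure_cylinder {b : ℕ} [NeZero b]
    (ν : Measure (SymbolicSpace b)) (k : ℕ) : Measurable fun p : SymbolicSpace b × (ℕ → ℝ≥0) =>
      ((∏ j ∈ Finset.range k, p.2 j : ℝ≥0) : ℝ≥0∞) * ν (PiNat.cylinder p.1 k) := by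
  refine Measurable.mul ?_ ((measurable_measure_cylinder ν k).comp measurable_fst)
  exact (Finset.measurable_fun_prod _ fun j _ =>
    (measurable_pi_apply j).comp measurable_snd).coe_nnreal_ennreal

namespace IsMandelbrotCascade

variable {b : ℕ} {Ω Ω' : Type*} [MeasurableSpace Ω] [MeasurableSpace Ω'] {P : Measure Ω}
  {P' : Measure Ω'} {W : List (Fin b) → Ω → ℝ≥0} {X : Ω' → ℝ≥0}
  {ν : Measure (SymbolicSpace b)}

/-- Makes `Q_m(x)` times the indicator of the good event an admissible `F` in
`lintegral_mul_cascadeMeasure_cylinder_le`: it involves only weights of prefixes of `x`. -/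
theorem measurable_weightSigma_indicator (hW : IsMandelbrotCascade P W P' X)
    (x : SymbolicSpace b) (c ε : ℝ) (N m : ℕ) :
    Measurable[hW.weightSigma (Set.range x.word)] fun ω => (cascadeDensity W m ω x : ℝ≥0∞) *
      (irregularDensitySet W ν c ε N m)ᶜ.indicator 1 (ω, x) := by
  have hQ : ∀ k, Measurable[hW.weightSigma (Set.range x.word)]
      fun ω => (cascadeDensity W k ω x : ℝ≥0∞) := fun k =>
    Measurable.coe_nnreal_ennreal (Finset.measurable_fun_prod _ fun j _ =>
      hW.measurable_weightSigma (x.take_ne_nil j) ⟨j, rfl⟩)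
  have hA : MeasurableSet[hW.weightSigma (Set.range x.word)]
      {ω | (ω, x) ∈ (irregularDensitySet W ν c ε N m)ᶜ} := by
    have : {ω | (ω, x) ∈ (irregularDensitySet W ν c ε N m)ᶜ} =
        (⋃ k, ⋃ _ : N ≤ k, ⋃ _ : k ≤ m, (fun ω =>
        (cascadeDensity W k ω x : ℝ≥0∞) * ν (PiNat.cylinder x k)) ⁻¹' (decayInterval c ε k)ᶜ)ᶜ := by
      ext; simp [irregularDensitySet]
    rw [this]
    refine MeasurableSet.compl (.iUnion fun k => .iUnion fun _ => .iUnion fun _ => ?_)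
    exact (Measurable.mul_const (hQ k) _) measurableSet_Icc.compl
  have hI : Measurable[hW.weightSigma (Set.range x.word)]
      ({ω | (ω, x) ∈ (irregularDensitySet W ν c ε N m)ᶜ}.indicator fun _ => (1 : ℝ≥0∞)) :=
    Measurable.indicator measurable_const hA
  exact Measurable.mul (hQ m) hI

variable [NeZero b]

theorem measurableSet_irregularDensitySet (hW : IsMandelbrotCascade P W P' X) (c ε : ℝ)
    (N m : ℕ) : MeasurableSet (irregularDensitySet W ν c ε N m) := by
  have : irregularDensitySet W ν c ε N m =
      ⋃ k, ⋃ _ : N ≤ k, ⋃ _ : k ≤ m, (fun p : Ω × SymbolicSpace b =>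
        (cascadeDensity W k p.1 p.2 : ℝ≥0∞) * ν (PiNat.cylinder p.2 k)) ⁻¹'
          (decayInterval c ε k)ᶜ := by
    ext
    simp only [irregularDensitySet, Set.mem_iUnion, exists_prop]
    rfl
  rw [this]
  exact .iUnion fun k => .iUnion fun _ => .iUnion fun _ =>
    ((hW.measurable_uncurry_cascadeDensity k).mul
      ((SymbolicSpace.measurable_measure_cylinder ν k).comp measurable_snd)) measurableSet_Icc.compl

variable [IsProbabilityMeasure ν]

theorem measurable_cascadeMeasure_cylinder (hW : IsMandelbrotCascade P W P' X) (m k : ℕ) :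
    Measurable fun p : Ω × SymbolicSpace b =>
      (cascadeMeasure W ν m p.1 : Measure (SymbolicSpace b)) (PiNat.cylinder p.2 k) :=
  SymbolicSpace.measurable_uncurry_of_cylinder (F := fun ω x =>
    (cascadeMeasure W ν m ω : Measure (SymbolicSpace b)) (PiNat.cylinder x k)) k
    (fun ω x y h => by rw [PiNat.mem_cylinder_iff_eq.1 h])
    fun x => hW.measurable_cascadeMeasure (SymbolicSpace.isClopen_cylinder x k).isOpen.measurableSet m

theorem measurableSet_irregularSet (hW : IsMandelbrotCascade P W P' X) (c ε : ℝ) (N M m : ℕ) :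
    MeasurableSet {p : Ω × SymbolicSpace b |
      p.2 ∈ irregularSet (cascadeMeasure W ν m p.1 : Measure (SymbolicSpace b)) c ε N M} := by
  have : {p : Ω × SymbolicSpace b |
      p.2 ∈ irregularSet (cascadeMeasure W ν m p.1 : Measure (SymbolicSpace b)) c ε N M} =
      ⋃ k, ⋃ _ : N ≤ k, ⋃ _ : k ≤ M, (fun p : Ω × SymbolicSpace b =>
        (cascadeMeasure W ν m p.1 : Measure (SymbolicSpace b)) (PiNat.cylinder p.2 k)) ⁻¹'
          (decayInterval c ε k)ᶜ := by
    ext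
    simp only [irregularSet, Set.mem_iUnion, exists_prop]
    rfl
  rw [this]
  exact .iUnion fun k => .iUnion fun _ => .iUnion fun _ =>
    hW.measurable_cascadeMeasure_cylinder m k measurableSet_Icc.compl

theorem measurable_cascadeMeasure_section (hW : IsMandelbrotCascade P W P' X) (m : ℕ)
    {A : Set (Ω × SymbolicSpace b)} (hA : MeasurableSet A) :
    Measurable fun ω => (cascadeMeasure W ν m ω : Measure (SymbolicSpace b)) {x | (ω, x) ∈ A} := by
  have h := Measurable.lintegral_prod_right' (ν := ν)
    ((hW.measurable_uncurry_cascadeDensity m).indicator hA)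
  convert h using 2 with ω
  have hAω : MeasurableSet {x | (ω, x) ∈ A} := measurable_prodMk_left hA
  rw [cascadeMeasure_apply W ν m ω hAω, ← lintegral_indicator hAω]
  rfl

theorem peyriereMeasure_apply (hW : IsMandelbrotCascade P W P' X) (m : ℕ)
    {A : Set (Ω × SymbolicSpace b)} (hA : MeasurableSet A) :
    peyriereMeasure P W ν m A =
      ∫⁻ ω, (cascadeMeasure W ν m ω : Measure (SymbolicSpace b)) {x | (ω, x) ∈ A} ∂P := by
  have hQ : Measurable fun p : Ω × SymbolicSpace b => (cascadeDensity W m p.1 p.2 : ℝ≥0∞) :=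
    hW.measurable_uncurry_cascadeDensity m
  rw [peyriereMeasure, withDensity_apply _ hA, ← lintegral_indicator hA,
    lintegral_prod _ (hQ.indicator hA).aemeasurable]
  refine lintegral_congr fun ω => ?_
  have hAω : MeasurableSet {x | (ω, x) ∈ A} := measurable_prodMk_left hA
  rw [cascadeMeasure_apply W ν m ω hAω, ← lintegral_indicator hAω]
  rfl

variable [IsProbabilityMeasure P]

/-- Integrating over `ω` first, with `x` fixed, shows the size-biased weights along `x`; the order
in `peyriereMeasure_apply` shows mean masses of the random measures. -/
theorem lintegral_peyriereMeasure (hW : IsMandelbrotCascade P W P' X) (m : ℕ)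
    {f : Ω × SymbolicSpace b → ℝ≥0∞} (hf : Measurable f) :
    ∫⁻ p, f p ∂(peyriereMeasure P W ν m) =
      ∫⁻ x, ∫⁻ ω, cascadeDensity W m ω x * f (ω, x) ∂P ∂ν := by
  have hQ : Measurable fun p : Ω × SymbolicSpace b => (cascadeDensity W m p.1 p.2 : ℝ≥0∞) :=
    hW.measurable_uncurry_cascadeDensity m
  rw [peyriereMeasure, lintegral_withDensity_eq_lintegral_mul _ hQ hf,
    lintegral_prod_symm' _ (hQ.mul hf)]
  rfl

/-- For fixed `x` the event depends on the first `m` weights along `x`, which are size-biased.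
Dropping the constraint `k ≤ m` afterwards makes the bound independent of `m`. -/
theorem peyriereMeasure_irregularDensitySet_le (hW : IsMandelbrotCascade P W P' X) (c ε : ℝ)
    (N m : ℕ) :
    peyriereMeasure P W ν m (irregularDensitySet W ν c ε N m) ≤
      (ν.prod (Measure.infinitePi fun _ : ℕ => sizeBiasedLaw P' X))
        {p | ∃ k, N ≤ k ∧ ¬ ((∏ j ∈ Finset.range k, p.2 j : ℝ≥0) : ℝ≥0∞) *
          ν (PiNat.cylinder p.1 k) ∈ decayInterval c ε k} := by
  have := isProbabilityMeasure_sizeBiasedLaw hW.aemeasurable hW.mean_one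
  have hA := hW.measurableSet_irregularDensitySet (ν := ν) c ε N m
  have hmE : ∀ (x : SymbolicSpace b) k, Measurable fun t : ℕ → ℝ≥0 =>
      ((∏ j ∈ Finset.range k, t j : ℝ≥0) : ℝ≥0∞) * ν (PiNat.cylinder x k) := fun x k => by
    fun_prop
  rw [← lintegral_indicator_one hA, hW.lintegral_peyriereMeasure m (measurable_one.indicator hA)]
  have hT : MeasurableSet {p : SymbolicSpace b × (ℕ → ℝ≥0) | ∃ k, N ≤ k ∧
      ¬ ((∏ j ∈ Finset.range k, p.2 j : ℝ≥0) : ℝ≥0∞) * ν (PiNat.cylinder p.1 k) ∈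
        decayInterval c ε k} := by
    have : {p : SymbolicSpace b × (ℕ → ℝ≥0) | ∃ k, N ≤ k ∧
        ¬ ((∏ j ∈ Finset.range k, p.2 j : ℝ≥0) : ℝ≥0∞) * ν (PiNat.cylinder p.1 k) ∈
          decayInterval c ε k} = ⋃ k, ⋃ _ : N ≤ k, (fun p : SymbolicSpace b × (ℕ → ℝ≥0) =>
        ((∏ j ∈ Finset.range k, p.2 j : ℝ≥0) : ℝ≥0∞) * ν (PiNat.cylinder p.1 k)) ⁻¹'
          (decayInterval c ε k)ᶜ := by
      ext
      simp only [Set.mem_iUnion, exists_prop]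
      rfl
    rw [this]
    exact .iUnion fun k => .iUnion fun _ =>
      SymbolicSpace.measurable_prod_mul_measure_cylinder ν k measurableSet_Icc.compl
  rw [Measure.prod_apply hT]
  refine lintegral_mono fun x => ?_
  let E : Set (ℕ → ℝ≥0) := {t | ∃ k, N ≤ k ∧ k ≤ m ∧
    ((∏ j ∈ Finset.range k, t j : ℝ≥0) : ℝ≥0∞) * ν (PiNat.cylinder x k) ∉ decayInterval c ε k}
  have hE : MeasurableSet E := by
    have : E = ⋃ k, ⋃ _ : N ≤ k, ⋃ _ : k ≤ m, (fun t : ℕ → ℝ≥0 =>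
      ((∏ j ∈ Finset.range k, t j : ℝ≥0) : ℝ≥0∞) * ν (PiNat.cylinder x k)) ⁻¹'
        (decayInterval c ε k)ᶜ := by
      ext
      simp only [E, Set.mem_iUnion, exists_prop]
      rfl
    rw [this]
    exact .iUnion fun k => .iUnion fun _ => .iUnion fun _ => hmE x k measurableSet_Icc.compl
  have h := hW.lintegral_cascadeDensity_mul_indicator x m hE (by
    rintro s t hst ⟨k, hk, hkm, hks⟩
    refine ⟨k, hk, hkm, ?_⟩
    rwa [← Finset.prod_congr rfl fun j hj => hst j ((Finset.mem_range.1 hj).trans_le hkm)])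
  refine le_trans (le_of_eq ?_) (h.trans_le (measure_mono ?_))
  · rfl
  · rintro t ⟨k, hk, -, hkt⟩
    exact ⟨k, hk, hkt⟩

/-- For fixed `ω` the event is a union of level-`k` cylinders, each with `Q_m ν`-mass below `r`
times its `Q_k ν`-mass. Summing over words leaves `r` times the total mass of `Q_k ν`, which has
mean one. -/
theorem peyriereMeasure_lt_mul_le (hW : IsMandelbrotCascade P W P' X) (r : ℝ≥0∞) (k m : ℕ) :
    peyriereMeasure P W ν m {p |
      (cascadeMeasure W ν m p.1 : Measure (SymbolicSpace b)) (PiNat.cylinder p.2 k) <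
        r * ((cascadeDensity W k p.1 p.2 : ℝ≥0∞) * ν (PiNat.cylinder p.2 k))} ≤ r := by
  have hA : MeasurableSet {p : Ω × SymbolicSpace b |
      (cascadeMeasure W ν m p.1 : Measure (SymbolicSpace b)) (PiNat.cylinder p.2 k) <
        r * ((cascadeDensity W k p.1 p.2 : ℝ≥0∞) * ν (PiNat.cylinder p.2 k))} :=
    measurableSet_lt (hW.measurable_cascadeMeasure_cylinder m k)
      (((hW.measurable_uncurry_cascadeDensity k).mul
        ((SymbolicSpace.measurable_measure_cylinder ν k).comp measurable_snd)).const_mul r)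
  rw [hW.peyriereMeasure_apply m hA]
  have h : ∀ ω, (cascadeMeasure W ν m ω : Measure (SymbolicSpace b)) {x | (ω, x) ∈
      {p : Ω × SymbolicSpace b |
      (cascadeMeasure W ν m p.1 : Measure (SymbolicSpace b)) (PiNat.cylinder p.2 k) <
        r * ((cascadeDensity W k p.1 p.2 : ℝ≥0∞) * ν (PiNat.cylinder p.2 k))}} ≤
      r * (cascadeMeasure W ν k ω : Measure (SymbolicSpace b)) Set.univ := by
    intro ω
    have hAω : MeasurableSet {x | (ω, x) ∈ {p : Ω × SymbolicSpace b |
      (cascadeMeasure W ν m p.1 : Measure (SymbolicSpace b)) (PiNat.cylinder p.2 k) <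
        r * ((cascadeDensity W k p.1 p.2 : ℝ≥0∞) * ν (PiNat.cylinder p.2 k))}} :=
      measurable_prodMk_left hA
    rw [← lintegral_indicator_one hAω,
      SymbolicSpace.lintegral_eq_sum (k := k), cascadeMeasure_apply W ν k ω .univ,
      Measure.restrict_univ, SymbolicSpace.lintegral_eq_sum ν (k := k)
        (f := fun x => (cascadeDensity W k ω x : ℝ≥0∞)), Finset.mul_sum]
    · refine Finset.sum_le_sum fun v _ => ?_
      by_cases hv : SymbolicSpace.extend k v ∈ {x | (ω, x) ∈ {p : Ω × SymbolicSpace b |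
          (cascadeMeasure W ν m p.1 : Measure (SymbolicSpace b)) (PiNat.cylinder p.2 k) <
          r * ((cascadeDensity W k p.1 p.2 : ℝ≥0∞) * ν (PiNat.cylinder p.2 k))}}
      · rw [Set.indicator_of_mem hv, Pi.one_apply, one_mul]
        exact le_of_lt hv
      · rw [Set.indicator_of_notMem hv, zero_mul]
        exact zero_le
    · intro x y hy
      rw [cascadeDensity_congr W ω hy le_rfl]
    · intro x y hy
      simp only [Set.indicator_apply, Pi.one_apply, Set.mem_ofPred_eq, PiNat.mem_cylinder_iff_eq.1 hy,
        cascadeDensity_congr W ω hy le_rfl]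
  refine (lintegral_mono h).trans (le_of_eq ?_)
  rw [lintegral_const_mul _ (hW.measurable_cascadeMeasure .univ k),
    hW.lintegral_cascadeMeasure_apply .univ, measure_univ, mul_one]

/-- On the good event `Q_j(x) ν([x|_j]) ≤ exp(-j(c - ε))` for every branching level `j` from `k` to
`m`. The remaining factor `Q_m(x)` has mean one, and a geometric tail is left. -/
theorem lintegral_cylinder_le (hW : IsMandelbrotCascade P W P' X) (x : SymbolicSpace b)
    (c ε : ℝ) {N k m : ℕ} (hNk : N ≤ k) (hkm : k ≤ m) :
    ∫⁻ ω, (cascadeDensity W m ω x : ℝ≥0∞) *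
        (irregularDensitySet W ν c ε N m)ᶜ.indicator 1 (ω, x) *
        (cascadeMeasure W ν m ω : Measure (SymbolicSpace b)) (PiNat.cylinder x k) ∂P ≤
      (1 - ENNReal.ofReal (Real.exp (-(c - ε))))⁻¹ *
        ENNReal.ofReal (Real.exp (-(c - ε))) ^ k := by
  refine (hW.lintegral_mul_cascadeMeasure_cylinder_le
    (hW.measurable_weightSigma_indicator x c ε N m) hkm).trans ?_
  refine le_trans (Finset.sum_le_sum fun j hj => ?_) (ENNReal.sum_Icc_pow_le _ k m)
  rw [← lintegral_const_mul' _ _ (measure_ne_top ν _)]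
  obtain ⟨hkj, hjm⟩ := Finset.mem_Icc.1 hj
  calc ∫⁻ ω, ν (PiNat.cylinder x j) * ((cascadeDensity W m ω x : ℝ≥0∞) *
        (irregularDensitySet W ν c ε N m)ᶜ.indicator 1 (ω, x) * cascadeDensity W j ω x) ∂P
      ≤ ∫⁻ ω, ENNReal.ofReal (Real.exp (-(c - ε))) ^ j * cascadeDensity W m ω x ∂P := by
        refine lintegral_mono fun ω => ?_
        by_cases h : (ω, x) ∈ irregularDensitySet W ν c ε N m
        · simp [h]
        · have hdec : (cascadeDensity W j ω x : ℝ≥0∞) * ν (PiNat.cylinder x j) ∈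
              decayInterval c ε j := by
            by_contra hc
            exact h ⟨j, hNk.trans hkj, hjm, hc⟩
          have h2 := hdec.2
          rw [ENNReal.ofReal_exp_neg_natCast_mul] at h2
          rw [Set.indicator_of_mem h, Pi.one_apply, mul_one]
          calc ν (PiNat.cylinder x j) * ((cascadeDensity W m ω x : ℝ≥0∞) * cascadeDensity W j ω x)
              = (cascadeDensity W j ω x : ℝ≥0∞) * ν (PiNat.cylinder x j) *
                cascadeDensity W m ω x := by ring
            _ ≤ _ := mul_le_mul_left h2 _
    _ = ENNReal.ofReal (Real.exp (-(c - ε))) ^ j := by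
        rw [lintegral_const_mul _ (hW.measurable_cascadeDensity x m).coe_nnreal_ennreal,
          hW.lintegral_cascadeDensity, mul_one]

/-- Markov's inequality: the threshold exceeds the order `exp(-k(c - ε))` of the mean by `exp(kε)`,
which leaves the summable factor `exp(-kε)`. -/
theorem peyriereMeasure_lt_cylinder_le (hW : IsMandelbrotCascade P W P' X) (c ε : ℝ)
    {N k m : ℕ} (hNk : N ≤ k) (hkm : k ≤ m) :
    peyriereMeasure P W ν m {p | p ∉ irregularDensitySet W ν c ε N m ∧
      ENNReal.ofReal (Real.exp (-(k * (c - 2 * ε)))) <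
        (cascadeMeasure W ν m p.1 : Measure (SymbolicSpace b)) (PiNat.cylinder p.2 k)} ≤
      (1 - ENNReal.ofReal (Real.exp (-(c - ε))))⁻¹ * ENNReal.ofReal (Real.exp (-ε)) ^ k := by
  set t := ENNReal.ofReal (Real.exp (-(k * (c - 2 * ε)))) with ht
  set s := ENNReal.ofReal (Real.exp (k * (c - 2 * ε))) with hs
  have hst : s * t = 1 := by
    rw [hs, ht, ← ENNReal.ofReal_mul (Real.exp_pos _).le, ← Real.exp_add]
    simp
  have hA := hW.measurableSet_irregularDensitySet (ν := ν) c ε N m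
  let f : Ω × SymbolicSpace b → ℝ≥0∞ := fun p =>
    (irregularDensitySet W ν c ε N m)ᶜ.indicator 1 p *
      (cascadeMeasure W ν m p.1 : Measure (SymbolicSpace b)) (PiNat.cylinder p.2 k)
  have hf : Measurable f :=
    (measurable_one.indicator hA.compl).mul (hW.measurable_cascadeMeasure_cylinder m k)
  have hint : ∫⁻ p, f p ∂(peyriereMeasure P W ν m) ≤
      (1 - ENNReal.ofReal (Real.exp (-(c - ε))))⁻¹ *
        ENNReal.ofReal (Real.exp (-(c - ε))) ^ k := by
    rw [hW.lintegral_peyriereMeasure m hf]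
    refine (lintegral_mono (g := fun _ => (1 - ENNReal.ofReal (Real.exp (-(c - ε))))⁻¹ *
      ENNReal.ofReal (Real.exp (-(c - ε))) ^ k) fun x => ?_).trans_eq (by simp)
    refine le_trans (le_of_eq ?_) (hW.lintegral_cylinder_le (ν := ν) x c ε hNk hkm)
    exact lintegral_congr fun ω => (mul_assoc _ _ _).symm
  have hmark := mul_meas_ge_le_lintegral (μ := peyriereMeasure P W ν m) hf t
  calc peyriereMeasure P W ν m {p | p ∉ irregularDensitySet W ν c ε N m ∧ t <
        (cascadeMeasure W ν m p.1 : Measure (SymbolicSpace b)) (PiNat.cylinder p.2 k)}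
      ≤ peyriereMeasure P W ν m {p | t ≤ f p} := by
        refine measure_mono fun p hp => ?_
        have : p ∈ (irregularDensitySet W ν c ε N m)ᶜ := hp.1
        simp only [Set.mem_ofPred_eq, f]
        rw [Set.indicator_of_mem this, Pi.one_apply, one_mul]
        exact hp.2.le
    _ = s * (t * peyriereMeasure P W ν m {p | t ≤ f p}) := by rw [← mul_assoc, hst, one_mul]
    _ ≤ s * ((1 - ENNReal.ofReal (Real.exp (-(c - ε))))⁻¹ *
        ENNReal.ofReal (Real.exp (-(c - ε))) ^ k) := mul_le_mul_right (hmark.trans hint) _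
    _ = (1 - ENNReal.ofReal (Real.exp (-(c - ε))))⁻¹ *
        (s * ENNReal.ofReal (Real.exp (-(c - ε))) ^ k) := by ring
    _ = _ := by
        rw [← ENNReal.ofReal_exp_neg_natCast_mul, ← ENNReal.ofReal_exp_neg_natCast_mul, hs,
          ← ENNReal.ofReal_mul (Real.exp_pos _).le, ← Real.exp_add]
        ring_nf

/-- The tolerance `2 * ε` is spent twice: one `ε` on `Q_k ν([x|_k])`, one on its comparison with the
mass of the cylinder. The sets `B k` and `B' k` collect masses that are too small and too large. -/
theorem peyriereMeasure_irregularSet_le (hW : IsMandelbrotCascade P W P' X) (c ε : ℝ)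
    {N M m : ℕ} (hMm : M ≤ m) :
    peyriereMeasure P W ν m {p |
      p.2 ∈ irregularSet (cascadeMeasure W ν m p.1 : Measure (SymbolicSpace b)) c (2 * ε) N M} ≤
      peyriereMeasure P W ν m (irregularDensitySet W ν c ε N m) +
        (1 + (1 - ENNReal.ofReal (Real.exp (-(c - ε))))⁻¹) *
          ((1 - ENNReal.ofReal (Real.exp (-ε)))⁻¹ * ENNReal.ofReal (Real.exp (-ε)) ^ N) := by
  set r := ENNReal.ofReal (Real.exp (-ε)) with hr
  set C := (1 - ENNReal.ofReal (Real.exp (-(c - ε))))⁻¹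
  let B : ℕ → Set (Ω × SymbolicSpace b) := fun k => {p |
      (cascadeMeasure W ν m p.1 : Measure (SymbolicSpace b)) (PiNat.cylinder p.2 k) <
        r ^ k * ((cascadeDensity W k p.1 p.2 : ℝ≥0∞) * ν (PiNat.cylinder p.2 k))}
  let B' : ℕ → Set (Ω × SymbolicSpace b) := fun k => {p | p ∉ irregularDensitySet W ν c ε N m ∧
      ENNReal.ofReal (Real.exp (-(k * (c - 2 * ε)))) <
        (cascadeMeasure W ν m p.1 : Measure (SymbolicSpace b)) (PiNat.cylinder p.2 k)}
  have hsub : {p : Ω × SymbolicSpace b |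
      p.2 ∈ irregularSet (cascadeMeasure W ν m p.1 : Measure (SymbolicSpace b)) c (2 * ε) N M} ⊆
      irregularDensitySet W ν c ε N m ∪ ⋃ k ∈ Finset.Icc N M, (B k ∪ B' k) := by
    rintro p ⟨k, hNk, hkM, hk⟩
    by_cases hp : p ∈ irregularDensitySet W ν c ε N m
    · exact Or.inl hp
    · refine Or.inr (Set.mem_iUnion₂.2 ⟨k, Finset.mem_Icc.2 ⟨hNk, hkM⟩, ?_⟩)
      have hdec : (cascadeDensity W k p.1 p.2 : ℝ≥0∞) * ν (PiNat.cylinder p.2 k) ∈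
          decayInterval c ε k := by
        by_contra hc
        exact hp ⟨k, hNk, hkM.trans hMm, hc⟩
      rcases lt_or_ge ((cascadeMeasure W ν m p.1 : Measure (SymbolicSpace b))
        (PiNat.cylinder p.2 k)) (ENNReal.ofReal (Real.exp (-(k * (c + 2 * ε))))) with h | h
      · refine Or.inl (h.trans_le ((le_of_eq ?_).trans (mul_le_mul_right hdec.1 _)))
        rw [hr, ← ENNReal.ofReal_exp_neg_natCast_mul, ← ENNReal.ofReal_mul (Real.exp_pos _).le,
          ← Real.exp_add]
        ring_nf
      · exact Or.inr ⟨hp, lt_of_not_ge fun h' => hk ⟨h, h'⟩⟩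
  calc _ ≤ peyriereMeasure P W ν m (irregularDensitySet W ν c ε N m) +
        peyriereMeasure P W ν m (⋃ k ∈ Finset.Icc N M, (B k ∪ B' k)) :=
        (measure_mono hsub).trans (measure_union_le _ _)
    _ ≤ peyriereMeasure P W ν m (irregularDensitySet W ν c ε N m) +
        ∑ k ∈ Finset.Icc N M, (1 + C) * r ^ k := by
        refine add_le_add le_rfl ((measure_biUnion_finset_le _ _).trans
          (Finset.sum_le_sum fun k hk => ?_))
        obtain ⟨hNk, hkM⟩ := Finset.mem_Icc.1 hk
        rw [add_mul, one_mul]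
        exact (measure_union_le _ _).trans (add_le_add (hW.peyriereMeasure_lt_mul_le _ k m)
          (hW.peyriereMeasure_lt_cylinder_le c ε hNk (hkM.trans hMm)))
    _ ≤ _ := by
        rw [← Finset.mul_sum]
        exact add_le_add le_rfl (mul_le_mul_right (ENNReal.sum_Icc_pow_le r N M) _)

/-- Uniformly in `m`, the measures `Q_m ν` put little mass, in the mean, on the points where the
cylinder masses deviate from the expected decay at some level between `N` and `M`. -/
theorem exists_tendsto_zero_lintegral_irregularSet_le (hW : IsMandelbrotCascade P W P' X)
    (hint : Integrable (fun ω => (X ω : ℝ) * Real.log (X ω)) P') {D : ℝ}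
    (hν : SymbolicSpace.IsExactDimensional ν D) {c ε : ℝ}
    (hc : c = D - ∫ ω, (X ω : ℝ) * Real.log (X ω) ∂P') (hε : 0 < ε) (hεc : ε < c) :
    ∃ δ : ℕ → ℝ≥0∞, Tendsto δ atTop (𝓝 0) ∧ ∀ N M m, M ≤ m →
      ∫⁻ ω, (cascadeMeasure W ν m ω : Measure (SymbolicSpace b))
        (irregularSet (cascadeMeasure W ν m ω : Measure (SymbolicSpace b)) c (2 * ε) N M) ∂P ≤
        δ N := by
  have := isProbabilityMeasure_sizeBiasedLaw hW.aemeasurable hW.mean_one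
  set τ := Measure.infinitePi fun _ : ℕ => sizeBiasedLaw P' X
  let η : ℕ → ℝ≥0∞ := fun N => (ν.prod τ)
    {p | ∃ k, N ≤ k ∧ ¬ ((∏ j ∈ Finset.range k, p.2 j : ℝ≥0) : ℝ≥0∞) *
      ν (PiNat.cylinder p.1 k) ∈ decayInterval c ε k}
  have hη : Tendsto η atTop (𝓝 0) := by
    refine tendsto_measure_exists_ge_of_ae_eventually (fun k => ?_) ?_
    · exact SymbolicSpace.measurable_prod_mul_measure_cylinder ν k measurableSet_Icc
    -- Half of `ε` goes to the local dimension of `ν`, half to the law of large numbers.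
    · have h1 : ∀ᵐ p ∂(ν.prod τ), ∀ᶠ k in atTop,
          ν (PiNat.cylinder p.1 k) ∈ decayInterval D (ε / 2) k :=
        Measure.quasiMeasurePreserving_fst.ae (hν.2.mono fun x hx =>
          eventually_mem_decayInterval_of_liminf_of_limsup hx.1 hx.2 (half_pos hε))
      have h2 : ∀ᵐ p ∂(ν.prod τ), ∀ᶠ k in atTop,
          ((∏ j ∈ Finset.range k, p.2 j : ℝ≥0) : ℝ≥0∞) ∈
            decayInterval (-∫ ω, (X ω : ℝ) * Real.log (X ω) ∂P') (ε / 2) k :=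
        Measure.quasiMeasurePreserving_snd.ae
          (ae_eventually_prod_mem_decayInterval hW.aemeasurable hW.mean_one hint (half_pos hε))
      filter_upwards [h1, h2] with p hp1 hp2
      filter_upwards [hp1, hp2] with k hk1 hk2
      have h := mul_mem_decayInterval hk2 hk1
      rwa [add_halves, neg_add_eq_sub, ← hc] at h
  set r := ENNReal.ofReal (Real.exp (-ε))
  set C := (1 - ENNReal.ofReal (Real.exp (-(c - ε))))⁻¹ with hC
  have hr1 : r < 1 := ENNReal.ofReal_exp_neg_lt_one hε
  -- The condition `ε < c` puts the ratio of the branching series below one.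
  have hCtop : C ≠ ∞ := by
    rw [hC, ENNReal.inv_ne_top]
    exact (tsub_pos_of_lt (ENNReal.ofReal_exp_neg_lt_one (sub_pos.2 hεc))).ne'
  have hrtop : (1 - r)⁻¹ ≠ ∞ := ENNReal.inv_ne_top.2 (tsub_pos_of_lt hr1).ne'
  refine ⟨fun N => η N + (1 + C) * ((1 - r)⁻¹ * r ^ N), ?_, fun N M m hMm => ?_⟩
  · have h0 : Tendsto (fun N => (1 + C) * ((1 - r)⁻¹ * r ^ N)) atTop (𝓝 ((1 + C) * ((1 - r)⁻¹ * 0))) :=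
      ENNReal.Tendsto.const_mul (ENNReal.Tendsto.const_mul
        (ENNReal.tendsto_pow_atTop_nhds_zero_of_lt_one hr1) (Or.inr hrtop))
        (Or.inr (ENNReal.add_ne_top.2 ⟨ENNReal.one_ne_top, hCtop⟩))
    simpa using hη.add h0
  · have h := hW.peyriereMeasure_irregularSet_le (ν := ν) c ε (N := N) hMm
    rw [hW.peyriereMeasure_apply m (hW.measurableSet_irregularSet c (2 * ε) N M m)] at h
    exact h.trans (add_le_add (hW.peyriereMeasure_irregularDensitySet_le c ε N m) le_rfl)

end IsMandelbrotCascade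

/-! ### Passage to the weak limit and non-degeneracy. -/

theorem irregularSet_mono {b : ℕ} (ρ : Measure (SymbolicSpace b)) (c ε : ℝ) (N : ℕ) {M M' : ℕ}
    (h : M ≤ M') : irregularSet ρ c ε N M ⊆ irregularSet ρ c ε N M' :=
  fun _ ⟨k, hk, hkM, hx⟩ => ⟨k, hk, hkM.trans h, hx⟩

theorem FiniteMeasure.tendsto_coe_apply_of_isClopen {E ι : Type*} [TopologicalSpace E]
    [MeasurableSpace E] [OpensMeasurableSpace E] {s : Set E} (hs : IsClopen s) {l : Filter ι}
    {μ : ι → FiniteMeasure E} {ρ : FiniteMeasure E} (h : Tendsto μ l (𝓝 ρ)) :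
    Tendsto (fun i => (μ i : Measure E) s) l (𝓝 ((ρ : Measure E) s)) := by
  have := ((ENNReal.continuous_coe.comp (continuous_apply_of_isClopen hs)).tendsto ρ).comp h
  simpa [Function.comp_def] using this

/-- The mass of the irregular set is lower semicontinuous along weakly convergent sequences. -/
theorem measure_irregularSet_le_liminf {b : ℕ} [NeZero b]
    {μ : ℕ → FiniteMeasure (SymbolicSpace b)} {ρ : FiniteMeasure (SymbolicSpace b)}
    (h : Tendsto μ atTop (𝓝 ρ)) (c ε : ℝ) (N M : ℕ) :
    (ρ : Measure (SymbolicSpace b)) (irregularSet ρ c ε N M) ≤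
      liminf (fun m => (μ m : Measure (SymbolicSpace b)) (irregularSet (μ m) c ε N M)) atTop := by
  have hpt : ∀ x ∈ irregularSet (ρ : Measure (SymbolicSpace b)) c ε N M,
      ∀ᶠ m in atTop, x ∈ irregularSet (μ m : Measure (SymbolicSpace b)) c ε N M := by
    rintro x ⟨k, hk, hkM, hx⟩
    have ht := FiniteMeasure.tendsto_coe_apply_of_isClopen (SymbolicSpace.isClopen_cylinder x k) h
    filter_upwards [ht.eventually (isClosed_Icc.isOpen_compl.mem_nhds hx)] with m hm
    exact ⟨k, hk, hkM, hm⟩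
  -- Irregular sets are unions of level-`M` cylinders. These are finite in number, so pointwise
  -- eventual membership becomes an eventual inclusion.
  have hsub : ∀ᶠ m in atTop, irregularSet (ρ : Measure (SymbolicSpace b)) c ε N M ⊆
      irregularSet (μ m : Measure (SymbolicSpace b)) c ε N M := by
    have hall : ∀ᶠ m in atTop, ∀ v : Fin M → Fin b, SymbolicSpace.extend M v ∈
        irregularSet (ρ : Measure (SymbolicSpace b)) c ε N M → SymbolicSpace.extend M v ∈
        irregularSet (μ m : Measure (SymbolicSpace b)) c ε N M := by
      rw [eventually_all]
      intro v
      by_cases hv : SymbolicSpace.extend M v ∈ irregularSet (ρ : Measure (SymbolicSpace b)) c ε N M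
      · exact (hpt _ hv).mono fun _ hm _ => hm
      · exact Eventually.of_forall fun _ hv' => absurd hv' hv
    filter_upwards [hall] with m hm x hx
    have hx' := SymbolicSpace.mem_cylinder_extend M x
    exact mem_irregularSet_of_mem_cylinder hx' (hm _ (mem_irregularSet_of_mem_cylinder
      ((PiNat.mem_cylinder_comm _ _ _).1 hx') hx))
  rw [← (FiniteMeasure.tendsto_coe_apply_of_isClopen
    (isClopen_irregularSet (ρ : Measure (SymbolicSpace b)) c ε N M) h).liminf_eq]
  exact liminf_le_liminf (hsub.mono fun m hm => measure_mono hm)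

/-- A level-`N` cylinder of regular points has mass at most `exp(-N(c - ε)) ≤ 1`. The bound by the
number of words is deterministic and uniform in `m`, as dominated convergence requires. -/
theorem cascadeMeasure_compl_irregularSet_le {b : ℕ} [NeZero b] {Ω : Type*}
    {ν : Measure (SymbolicSpace b)} [IsProbabilityMeasure ν] (W : List (Fin b) → Ω → ℝ≥0) (m N : ℕ) (ω : Ω)
    {c ε : ℝ} (hεc : ε ≤ c) :
    (cascadeMeasure W ν m ω : Measure (SymbolicSpace b))
      (irregularSet (cascadeMeasure W ν m ω : Measure (SymbolicSpace b)) c ε N N)ᶜ ≤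
        Fintype.card (Fin N → Fin b) := by
  set μ := (cascadeMeasure W ν m ω : Measure (SymbolicSpace b))
  have hcl := isClopen_irregularSet μ c ε N N
  rw [← lintegral_indicator_one hcl.isOpen.measurableSet.compl,
    SymbolicSpace.lintegral_eq_sum (k := N)]
  · calc _ ≤ ∑ _ : Fin N → Fin b, (1 : ℝ≥0∞) := by
          refine Finset.sum_le_sum fun v _ => ?_
          by_cases hv : SymbolicSpace.extend N v ∈ (irregularSet μ c ε N N)ᶜ
          · rw [Set.indicator_of_mem hv, Pi.one_apply, one_mul]
            have hmem : μ (PiNat.cylinder (SymbolicSpace.extend N v) N) ∈ decayInterval c ε N := by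
              by_contra hc
              exact hv ⟨N, le_rfl, le_rfl, hc⟩
            refine hmem.2.trans (ENNReal.ofReal_le_one.2 (Real.exp_le_one_iff.2 ?_))
            have := mul_nonneg (Nat.cast_nonneg (α := ℝ) N) (sub_nonneg.2 hεc)
            linarith
          · rw [Set.indicator_of_notMem hv, zero_mul]
            exact zero_le
      _ = _ := by simp
  · intro x y hy
    have : y ∈ (irregularSet μ c ε N N)ᶜ ↔ x ∈ (irregularSet μ c ε N N)ᶜ :=
      not_congr ⟨mem_irregularSet_of_mem_cylinder ((PiNat.mem_cylinder_comm _ _ _).1 hy),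
        mem_irregularSet_of_mem_cylinder hy⟩
    by_cases hx : x ∈ (irregularSet μ c ε N N)ᶜ
    · rw [Set.indicator_of_mem hx, Set.indicator_of_mem (this.2 hx)]
      rfl
    · rw [Set.indicator_of_notMem hx, Set.indicator_of_notMem (this.not.2 hx)]

namespace IsMandelbrotCascade

variable {b : ℕ} {Ω Ω' : Type*} [MeasurableSpace Ω] [MeasurableSpace Ω'] {P : Measure Ω}
  {P' : Measure Ω'} {W : List (Fin b) → Ω → ℝ≥0} {X : Ω' → ℝ≥0}
  {ν : Measure (SymbolicSpace b)} [NeZero b] [IsProbabilityMeasure ν]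

theorem measurable_measure_irregularSet (hW : IsMandelbrotCascade P W P' X) (c ε : ℝ)
    (N M m : ℕ) : Measurable fun ω => (cascadeMeasure W ν m ω : Measure (SymbolicSpace b))
      (irregularSet (cascadeMeasure W ν m ω : Measure (SymbolicSpace b)) c ε N M) := by
  have h := hW.measurable_cascadeMeasure_section (ν := ν) m
    (hW.measurableSet_irregularSet (ν := ν) c ε N M m)
  exact h

variable [IsProbabilityMeasure P]

/-- Almost surely, the cylinder masses of the limit have the expected decay almost everywhere. -/
theorem ae_ae_eventually_mem_decayInterval (hW : IsMandelbrotCascade P W P' X) {c ε : ℝ}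
    {δ : ℕ → ℝ≥0∞} (hδ : Tendsto δ atTop (𝓝 0)) (h : ∀ N M m, M ≤ m →
      ∫⁻ ω, (cascadeMeasure W ν m ω : Measure (SymbolicSpace b))
        (irregularSet (cascadeMeasure W ν m ω : Measure (SymbolicSpace b)) c ε N M) ∂P ≤ δ N) :
    ∀ᵐ ω ∂P, ∀ᵐ x ∂(cascadeLimit W ν ω : Measure (SymbolicSpace b)), ∀ᶠ k in atTop,
      (cascadeLimit W ν ω : Measure (SymbolicSpace b)) (PiNat.cylinder x k) ∈
        decayInterval c ε k := by
  let a : ℕ → ℕ → Ω → ℝ≥0∞ := fun N M ω => liminf (fun m =>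
    (cascadeMeasure W ν m ω : Measure (SymbolicSpace b))
      (irregularSet (cascadeMeasure W ν m ω : Measure (SymbolicSpace b)) c ε N M)) atTop
  have ham : ∀ N M, Measurable (a N M) := fun N M =>
    .liminf fun m => hW.measurable_measure_irregularSet c ε N M m
  have hmono : ∀ N, Monotone (a N) := fun N M M' hM ω =>
    liminf_le_liminf (Eventually.of_forall fun m => measure_mono (irregularSet_mono _ c ε N hM))
  have hle : ∀ N M, ∫⁻ ω, a N M ω ∂P ≤ δ N := fun N M =>
    (lintegral_liminf_le fun m => hW.measurable_measure_irregularSet c ε N M m).trans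
      ((liminf_le_limsup (f := atTop)).trans (limsup_le_of_le (h := (eventually_ge_atTop M).mono fun m hm =>
        h N M m hm)))
  -- Fatou has removed `m`; monotone convergence now removes the upper level `M`, and letting `N`
  -- grow removes `δ`.
  have hsup : ∀ N, ∫⁻ ω, ⨆ M, a N M ω ∂P ≤ δ N := fun N => by
    rw [lintegral_iSup (ham N) (hmono N)]
    exact iSup_le (hle N)
  have hzero : ∫⁻ ω, ⨅ N, ⨆ M, a N M ω ∂P = 0 :=
    le_antisymm (ge_of_tendsto' hδ fun N =>
      (lintegral_mono fun ω => iInf_le _ N).trans (hsup N)) zero_le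
  rw [lintegral_eq_zero_iff (.iInf fun N => .iSup fun M => ham N M)] at hzero
  filter_upwards [hzero, hW.ae_tendsto_cascadeLimit (ν := ν)] with ω hω ht
  refine le_antisymm (le_trans (le_iInf fun N => ?_) (le_of_eq hω)) zero_le
  refine le_trans (measure_mono (t := ⋃ M, irregularSet (cascadeLimit W ν ω) c ε N M) ?_) ?_
  · intro x hx
    obtain ⟨k, hk, hkx⟩ := (frequently_atTop.1 (not_eventually.1 hx)) N
    exact Set.mem_iUnion.2 ⟨k, k, hk, le_rfl, hkx⟩
  · rw [(show Monotone fun M => irregularSet (cascadeLimit W ν ω : Measure (SymbolicSpace b)) c ε N M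
      from fun _ _ => irregularSet_mono _ c ε N).measure_iUnion]
    exact iSup_mono fun M => measure_irregularSet_le_liminf ht c ε N M

/-- If the limit vanished almost surely, the bounded masses `g m` of the regular part would have
means tending to zero. The irregular part has mean at most `δ N < 1`, yet the two means add up to
one. -/
theorem measure_cascadeLimit_ne_zero_pos (hW : IsMandelbrotCascade P W P' X) {c ε : ℝ}
    (hεc : ε ≤ c) {δ : ℕ → ℝ≥0∞} (hδ : Tendsto δ atTop (𝓝 0)) (h : ∀ N M m, M ≤ m →
      ∫⁻ ω, (cascadeMeasure W ν m ω : Measure (SymbolicSpace b))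
        (irregularSet (cascadeMeasure W ν m ω : Measure (SymbolicSpace b)) c ε N M) ∂P ≤ δ N) :
    0 < P {ω | cascadeLimit W ν ω ≠ 0} := by
  refine pos_iff_ne_zero.2 fun h0 => ?_
  have hae : ∀ᵐ ω ∂P, cascadeLimit W ν ω = 0 := by
    filter_upwards [measure_eq_zero_iff_ae_notMem.1 h0] with ω hω
    simpa using hω
  obtain ⟨N, hN⟩ := (hδ.eventually (gt_mem_nhds zero_lt_one)).exists
  let g : ℕ → Ω → ℝ≥0∞ := fun m ω => (cascadeMeasure W ν m ω : Measure (SymbolicSpace b))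
    (irregularSet (cascadeMeasure W ν m ω : Measure (SymbolicSpace b)) c ε N N)ᶜ
  have hgm : ∀ m, Measurable (g m) := fun m => by
    have h := hW.measurable_cascadeMeasure_section (ν := ν) m
      (hW.measurableSet_irregularSet (ν := ν) c ε N N m).compl
    exact h
  have hg0 : Tendsto (fun m => ∫⁻ ω, g m ω ∂P) atTop (𝓝 (∫⁻ _, 0 ∂P)) := by
    refine tendsto_lintegral_of_dominated_convergence (fun _ => Fintype.card (Fin N → Fin b)) hgm
      (fun m => ae_of_all _ fun ω => cascadeMeasure_compl_irregularSet_le W m N ω hεc) ?_ ?_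
    · rw [lintegral_const, measure_univ, mul_one]
      exact ENNReal.natCast_ne_top _
    · filter_upwards [hae, hW.ae_tendsto_cascadeLimit (ν := ν)] with ω hω ht
      rw [hω] at ht
      have ht' := FiniteMeasure.tendsto_coe_apply_of_isClopen isClopen_univ ht
      rw [FiniteMeasure.toMeasure_zero, Measure.coe_zero, Pi.zero_apply] at ht'
      exact tendsto_of_tendsto_of_tendsto_of_le_of_le tendsto_const_nhds ht'
        (fun _ => zero_le) fun m => measure_mono (Set.subset_univ _)
  rw [lintegral_zero] at hg0
  have hone : ∀ m, N ≤ m → 1 ≤ δ N + ∫⁻ ω, g m ω ∂P := by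
    intro m hm
    calc 1 = ∫⁻ ω, (cascadeMeasure W ν m ω : Measure (SymbolicSpace b)) Set.univ ∂P := by
          rw [hW.lintegral_cascadeMeasure_apply .univ, measure_univ]
      _ = ∫⁻ ω, ((cascadeMeasure W ν m ω : Measure (SymbolicSpace b))
          (irregularSet (cascadeMeasure W ν m ω : Measure (SymbolicSpace b)) c ε N N) + g m ω) ∂P :=
          lintegral_congr fun ω =>
            (measure_add_measure_compl (isClopen_irregularSet _ c ε N N).isOpen.measurableSet).symm
      _ ≤ _ := by
          rw [lintegral_add_right _ (hgm m)]
          exact add_le_add (h N N m hm) le_rfl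
  have hlim := ge_of_tendsto (tendsto_const_nhds.add hg0)
    ((eventually_ge_atTop N).mono hone)
  rw [add_zero] at hlim
  exact absurd hN hlim.not_gt

end IsMandelbrotCascade

theorem corollary2p3 {b : ℕ} (hb : 2 ≤ b)
    {Ω : Type*} [MeasurableSpace Ω] (P : Measure Ω) [IsProbabilityMeasure P]
    {Ω' : Type*} [MeasurableSpace Ω'] (P' : Measure Ω') [IsProbabilityMeasure P']
    (W : List (Fin b) → Ω → ℝ≥0) (X : Ω' → ℝ≥0) (hW : IsMandelbrotCascade P W P' X)
    (ν : Measure (SymbolicSpace b)) [IsProbabilityMeasure ν]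
    (D : ℝ) (hν : SymbolicSpace.IsExactDimensional ν D)
    (hD : entropyXLogX P' X < (D : EReal)) :
    (∀ᵐ ω ∂P, Tendsto (fun n => cascadeMeasure W ν n ω) atTop (𝓝 (cascadeLimit W ν ω))) ∧
    0 < P {ω | cascadeLimit W ν ω ≠ 0} ∧
    ∀ᵐ ω ∂P, cascadeLimit W ν ω ≠ 0 →
      SymbolicSpace.IsExactDimensional (cascadeLimit W ν ω : Measure (SymbolicSpace b))
        (D - (entropyXLogX P' X).toReal) := by
  have : NeZero b := ⟨by omega⟩
  obtain ⟨hint, hent⟩ := integrable_mul_log_of_entropyXLogX_lt hW.aemeasurable hD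
  rw [hent, EReal.coe_lt_coe_iff] at hD
  rw [hent, EReal.toReal_coe]
  set c := D - ∫ ω, (X ω : ℝ) * Real.log (X ω) ∂P' with hc
  have hc0 : 0 < c := sub_pos.2 hD
  -- The factor `c / 2` gives `2 * e j ≤ c`, with equality at `j = 0`, and so `e j < c`; both bounds
  -- are needed below.
  let e : ℕ → ℝ := fun j => c / 2 * (1 / ((j : ℝ) + 1))
  have hj : ∀ j : ℕ, 0 < 1 / ((j : ℝ) + 1) ∧ 1 / ((j : ℝ) + 1) ≤ 1 := fun j =>
    ⟨Nat.one_div_pos_of_nat, by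
      rw [div_le_one (by positivity)]
      linarith [Nat.cast_nonneg (α := ℝ) j]⟩
  have he0 : ∀ j, 0 < e j := fun j => mul_pos (half_pos hc0) (hj j).1
  have hec : ∀ j, 2 * e j ≤ c := fun j => by
    have := mul_le_mul_of_nonneg_left (hj j).2 hc0.le
    simp only [e]
    linarith
  have he : Tendsto (fun j => 2 * e j) atTop (𝓝 0) := by
    have := (tendsto_one_div_add_atTop_nhds_zero_nat (𝕜 := ℝ)).const_mul (c / 2) |>.const_mul 2
    simpa [e] using this
  choose δ hδ hδle using fun j => hW.exists_tendsto_zero_lintegral_irregularSet_le hint hν hc (he0 j)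
    (by linarith [hec j, he0 j])
  refine ⟨hW.ae_tendsto_cascadeLimit,
    hW.measure_cascadeLimit_ne_zero_pos (hec 0) (hδ 0) (hδle 0), ?_⟩
  have hall : ∀ᵐ ω ∂P, ∀ j, ∀ᵐ x ∂(cascadeLimit W ν ω : Measure (SymbolicSpace b)),
      ∀ᶠ k in atTop, (cascadeLimit W ν ω : Measure (SymbolicSpace b)) (PiNat.cylinder x k) ∈
        decayInterval c (2 * e j) k :=
    ae_all_iff.2 fun j => hW.ae_ae_eventually_mem_decayInterval (hδ j) (hδle j)
  filter_upwards [hall] with ω hω _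
  refine ⟨hc0, ?_⟩
  filter_upwards [ae_all_iff.2 hω] with x hx
  exact liminf_limsup_eq_of_mem_decayInterval he hx
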